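/- Let $\mathbb{H}=\mathbb{R}^n\times\mathbb{R}^n\times\mathbb{R}$ be the Heisenberg group with product $(x,u,\xi)(x',u',\xi')=(x+x',u+u',\xi+\xi'+\tfrac12(u\cdot x'-x\cdot u'))$, let $\Gamma=\mathbb{Z}^n\times\mathbb{Z}^n\times\tfrac12\mathbb{Z}$ and $M=\Gamma\backslash\mathbb{H}$. Identify functions on $M$ with left $\Gamma$-invariant functions on $\mathbb{H}$, and set $\|F\|_{L^2(M)}^2=\int_{[0,1)^{2n}\times[0,1/2)}|F(x,u,\xi)|^2\,dx\,du\,d\xi$. Let $t>0$, let $k\neq0$ be an integer and put $\lambda=-4\pi k$. Let $\mathcal{H}_k$ be the space of all $F\in L^2(M)$ with $F(x,u,\xi)=e^{4\pi ik\xi}F(x,u,0)=e^{-i\lambda\xi}F(x,u,0)$; identify such $F$ with $f(x,u)=F(x,u,0)$ and, conversely, $f$ with $F(x,u,\xi)=e^{-i\lambda\xi}f(x,u)$. For $s>0$ let $$p_s^\lambda(x,u)=(4\pi)^{-n}\Big(\frac{\lambda}{\sinh(\lambda s)}\Big)^n e^{-\frac{\lambda}{4}\coth(\lambda s)(x\cdot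 x+u\cdot u)},$$ $$f*_\lambda p_t^\lambda(z,w)=\int_{\mathbb{R}^{2n}}f(x',u')\,p_t^\lambda(z-x',w-u')\,e^{-i\frac{\lambda}{2}(w\cdot x'-z\cdot u')}\,dx'\,du'\qquad(z,w\in\mathbb{C}^n),$$ $$W_t^\lambda(x+iy,u+iv)=e^{\lambda(u\cdot y-v\cdot x)}\,p_{2t}^\lambda(2y,2v),$$ where $z\cdot w=\sum_j z_jw_j$ and $p_t^\lambda$ is extended holomorphically to $\mathbb{C}^{2n}$. Let $\mathcal{B}_{t,\Gamma}$ be the space of entire functions $G$ on $\mathbb{C}^{2n}$ with $G(z+\mathbf{m},w+\mathbf{n})=e^{2\pi ik(w\cdot\mathbf{m}-z\cdot\mathbf{n})}G(z,w)$ for all $\mathbf{m},\mathbf{n}\in\mathbb{Z}^n$ and $$\|G\|_{\mathcal{B}_{t,\Gamma}}^2=\frac{4^n}{2}\int_{\mathbb{R}^{2n}}\int_{[0,1)^{2n}}|G(x+iy,u+iv)|^2\,W_t^\lambda(x+iy,u+iv)\,dx\,du\,dy\,dv<\infty .$$ (1) For every $f\in\mathcal{S}(\mathbb{R}^{2n})$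 the twisted average $$A_\lambda f(x,u)=\sum_{\mathbf{a},\mathbf{b}\in\mathbb{Z}^n}e^{i\frac{\lambda}{2}(u\cdot\mathbf{a}-x\cdot\mathbf{b})}f(x+\mathbf{a},u+\mathbf{b})$$ converges absolutely at every point and belongs to $\mathcal{H}_k$; the function $T_t(A_\lambda f)=(A_\lambda f)*_\lambda p_t^\lambda$ belongs to $\mathcal{B}_{t,\Gamma}$, and $$\|T_t(A_\lambda f)\|_{\mathcal{B}_{t,\Gamma}}^2=\|A_\lambda f\|_{L^2(M)}^2 .$$ (2) For every $F\in\mathcal{H}_k$ the integral defining $f*_\lambda p_t^\lambda(z,w)$ converges absolutely for all $(z,w)\in\mathbb{C}^{2n}$ and defines an entire function extending the twisted convolution $f*_\lambda p_t^\lambda$ on $\mathbb{R}^{2n}$. The map $T_t:\mathcal{H}_k\to\mathcal{B}_{t,\Gamma}$, $F\mapsto f*_\lambda p_t^\lambda$, is well defined, linear and isometric: $\|T_t(F)\|_{\mathcal{B}_{t,\Gamma}}=\|F\|_{L^2(M)}$ for all $F\in\mathcal{H}_k$. -/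

import Mathlib

open MeasureTheory

namespace HeisNil

/-- The `(2n+1)`-dimensional Heisenberg group `ℝⁿ × ℝⁿ × ℝ`. -/
@[ext] structure Heis (n : ℕ) where
  x : Fin n → ℝ
  u : Fin n → ℝ
  ξ : ℝ

/-- `(x,u,ξ)(x',u',ξ') = (x+x', u+u', ξ+ξ'+½(u·x' - x·u'))`. -/
noncomputable instance (n : ℕ) : Mul (Heis n) where
  mul g h := ⟨g.x + h.x, g.u + h.u, g.ξ + h.ξ + (g.u ⬝ᵥ h.x - g.x ⬝ᵥ h.u) / 2⟩

instance (n : ℕ) : One (Heis n) where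
  one := ⟨0, 0, 0⟩

noncomputable instance (n : ℕ) : Inv (Heis n) where
  inv g := ⟨-g.x, -g.u, -g.ξ⟩

@[simp] theorem mul_x {n : ℕ} (g h : Heis n) : (g * h).x = g.x + h.x := rfl
@[simp] theorem mul_u {n : ℕ} (g h : Heis n) : (g * h).u = g.u + h.u := rfl
@[simp] theorem mul_ξ {n : ℕ} (g h : Heis n) :
    (g * h).ξ = g.ξ + h.ξ + (g.u ⬝ᵥ h.x - g.x ⬝ᵥ h.u) / 2 := rfl
@[simp] theorem one_x {n : ℕ} : (1 : Heis n).x = 0 := rfl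
@[simp] theorem one_u {n : ℕ} : (1 : Heis n).u = 0 := rfl
@[simp] theorem one_ξ {n : ℕ} : (1 : Heis n).ξ = 0 := rfl
@[simp] theorem inv_x {n : ℕ} (g : Heis n) : (g⁻¹).x = -g.x := rfl
@[simp] theorem inv_u {n : ℕ} (g : Heis n) : (g⁻¹).u = -g.u := rfl
@[simp] theorem inv_ξ {n : ℕ} (g : Heis n) : (g⁻¹).ξ = -g.ξ := rfl

noncomputable instance (n : ℕ) : Group (Heis n) :=
  Group.ofLeftAxioms
    (by
      intro a b c
      ext i
      · simp [add_assoc]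
      · simp [add_assoc]
      · simp only [mul_ξ, mul_x, mul_u, add_dotProduct, dotProduct_add]
        ring)
    (by intro a; ext i <;> simp)
    (by
      intro a
      ext i
      · simp
      · simp
      · simp [dotProduct_comm a.u a.x])

/-- The standard lattice `Γ = ℤⁿ × ℤⁿ × ½ℤ`. -/
noncomputable def latticeΓ (n : ℕ) : Subgroup (Heis n) where
  carrier := {g | (∃ a : Fin n → ℤ, g.x = fun i => (a i : ℝ)) ∧
    (∃ b : Fin n → ℤ, g.u = fun i => (b i : ℝ)) ∧ ∃ c : ℤ, g.ξ = (c : ℝ) / 2}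
  one_mem' := ⟨⟨0, by ext i; simp⟩, ⟨0, by ext i; simp⟩, ⟨0, by simp⟩⟩
  mul_mem' := by
    rintro g h ⟨⟨a, ha⟩, ⟨b, hb⟩, ⟨c, hc⟩⟩ ⟨⟨a', ha'⟩, ⟨b', hb'⟩, ⟨c', hc'⟩⟩
    refine ⟨⟨a + a', ?_⟩, ⟨b + b', ?_⟩, ⟨c + c' + (b ⬝ᵥ a' - a ⬝ᵥ b'), ?_⟩⟩
    · ext i; simp [ha, ha']
    · ext i; simp [hb, hb']
    · simp only [mul_ξ, ha, hb, hc, ha', hb', hc', dotProduct]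
      push_cast
      ring
  inv_mem' := by
    rintro g ⟨⟨a, ha⟩, ⟨b, hb⟩, ⟨c, hc⟩⟩
    refine ⟨⟨-a, ?_⟩, ⟨-b, ?_⟩, ⟨-c, ?_⟩⟩
    · ext i; simp [ha]
    · ext i; simp [hb]
    · simp [hc, neg_div]

/-- The cube `[0,1)ⁿ × [0,1)ⁿ` in `ℝ²ⁿ`. -/
def unitCube (n : ℕ) : Set ((Fin n → ℝ) × (Fin n → ℝ)) :=
  {q | (∀ i, q.1 i ∈ Set.Ico (0 : ℝ) 1) ∧ ∀ i, q.2 i ∈ Set.Ico (0 : ℝ) 1}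

/-- The fundamental domain `[0,1)ⁿ × [0,1)ⁿ × [0,½)` for left translation by `Γ` on the
Heisenberg group. -/
def fundDomain (n : ℕ) : Set (((Fin n → ℝ) × (Fin n → ℝ)) × ℝ) :=
  unitCube n ×ˢ Set.Ico (0 : ℝ) (1 / 2)

/-- The space `ℋ_k` of functions `F ∈ L²(Γ\ℍ)` with `F(x,u,ξ) = e^{4πikξ} F(x,u,0)`.
Functions on `Γ\ℍ` are identified with left `Γ`-invariant functions on `ℍ`, and integrals over
`Γ\ℍ` are Lebesgue integrals over the fundamental domain. -/
noncomputable def spaceH (n : ℕ) (k : ℤ) : Submodule ℂ (Heis n → ℂ) where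
  carrier := {F | (∀ γ ∈ latticeΓ n, ∀ h, F (γ * h) = F h) ∧
    (∀ x u ξ, F ⟨x, u, ξ⟩ = Complex.exp (4 * Real.pi * Complex.I * k * ξ) * F ⟨x, u, 0⟩) ∧
    MemLp (fun q : ((Fin n → ℝ) × (Fin n → ℝ)) × ℝ => F ⟨q.1.1, q.1.2, q.2⟩) 2
      (volume.restrict (fundDomain n))}
  zero_mem' := ⟨by simp, by simp, by simp⟩
  add_mem' := by
    rintro F G ⟨h1, h2, h3⟩ ⟨g1, g2, g3⟩
    refine ⟨fun γ hγ h => ?_, fun x u ξ => ?_, h3.add g3⟩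
    · simp [h1 γ hγ h, g1 γ hγ h]
    · simp only [Pi.add_apply, mul_add]
      rw [h2 x u ξ, g2 x u ξ]
  smul_mem' := by
    rintro c F ⟨h1, h2, h3⟩
    refine ⟨fun γ hγ h => ?_, fun x u ξ => ?_, h3.const_smul c⟩
    · simp [h1 γ hγ h]
    · simp only [Pi.smul_apply, smul_eq_mul]
      rw [h2 x u ξ]
      ring

/-- The norm of `L²(Γ\ℍ)`. -/
noncomputable def normM {n : ℕ} (F : Heis n → ℂ) : ℝ :=
  Real.sqrt (∫ q in fundDomain n, ‖F ⟨q.1.1, q.1.2, q.2⟩‖ ^ 2)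

/-- The function `F(x,u,ξ) = e^{-iλξ} f(x,u)` on `ℍ` that is identified with `f`. -/
noncomputable def lift {n : ℕ} (l : ℝ) (f : (Fin n → ℝ) × (Fin n → ℝ) → ℂ) : Heis n → ℂ :=
  fun h => Complex.exp (-(Complex.I * l * h.ξ)) * f (h.x, h.u)

/-- The function `f(x,u) = F(x,u,0)` on `ℝ²ⁿ` that is identified with `F`. -/
def slice {n : ℕ} (F : Heis n → ℂ) : (Fin n → ℝ) × (Fin n → ℝ) → ℂ :=
  fun q => F ⟨q.1, q.2, 0⟩

/-- The summand `e^{i(λ/2)(u·a - x·b)} f(x+a, u+b)` of the twisted average. -/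
noncomputable def avgTerm {n : ℕ} (l : ℝ) (f : (Fin n → ℝ) × (Fin n → ℝ) → ℂ)
    (q : (Fin n → ℝ) × (Fin n → ℝ)) (ab : (Fin n → ℤ) × (Fin n → ℤ)) : ℂ :=
  Complex.exp (Complex.I * (l / 2 : ℝ) *
      ((q.2 ⬝ᵥ (fun i => (ab.1 i : ℝ)) - q.1 ⬝ᵥ (fun i => (ab.2 i : ℝ)) : ℝ) : ℂ)) *
    f (q.1 + fun i => (ab.1 i : ℝ), q.2 + fun i => (ab.2 i : ℝ))

/-- The twisted average `A_λ f`, a sum over `(a,b) ∈ ℤⁿ × ℤⁿ`. -/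
noncomputable def twistedAvg {n : ℕ} (l : ℝ) (f : (Fin n → ℝ) × (Fin n → ℝ) → ℂ)
    (q : (Fin n → ℝ) × (Fin n → ℝ)) : ℂ :=
  ∑' ab : (Fin n → ℤ) × (Fin n → ℤ), avgTerm l f q ab

/-- The kernel `p_t^λ(x,u) = c_n λⁿ sinh(λt)⁻ⁿ e^{-(λ/4) coth(λt)(x²+u²)}` with
`c_n = (4π)⁻ⁿ`, the constant for which `p_t^λ` tends to the Dirac measure as `t → 0`. -/
noncomputable def heatKer {n : ℕ} (l t : ℝ) (x u : Fin n → ℝ) : ℝ :=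
  ((4 * Real.pi) ^ n)⁻¹ * (l / Real.sinh (l * t)) ^ n *
    Real.exp (-(l / 4 * (Real.cosh (l * t) / Real.sinh (l * t)) * (x ⬝ᵥ x + u ⬝ᵥ u)))

/-- The kernel `p_t^λ` at complex arguments, where `z² = ∑ z_j²`. -/
noncomputable def heatKerC {n : ℕ} (l t : ℝ) (z w : Fin n → ℂ) : ℂ :=
  (((4 * Real.pi) ^ n)⁻¹ * (l / Real.sinh (l * t)) ^ n : ℝ) *
    Complex.exp (-((l / 4 * (Real.cosh (l * t) / Real.sinh (l * t)) : ℝ) *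
      (z ⬝ᵥ z + w ⬝ᵥ w)))

/-- The `λ`-twisted convolution `f *_λ p_t^λ` on `ℝ²ⁿ`. -/
noncomputable def twistedConv {n : ℕ} (l t : ℝ) (f : (Fin n → ℝ) × (Fin n → ℝ) → ℂ)
    (x u : Fin n → ℝ) : ℂ :=
  ∫ q : (Fin n → ℝ) × (Fin n → ℝ), f q * heatKer l t (x - q.1) (u - q.2) *
    Complex.exp (-(Complex.I * (l / 2 : ℝ) * ((u ⬝ᵥ q.1 - x ⬝ᵥ q.2 : ℝ) : ℂ)))

/-- A real vector as a complex one. -/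
def toC {n : ℕ} (x : Fin n → ℝ) : Fin n → ℂ := fun i => (x i : ℂ)

/-- The vector `x + iy`. -/
noncomputable def cplx {n : ℕ} (x y : Fin n → ℝ) : Fin n → ℂ :=
  fun i => (x i : ℂ) + Complex.I * (y i : ℂ)

/-- The integrand of `f *_λ p_t^λ` at `(z,w) ∈ ℂ²ⁿ`. -/
noncomputable def transformIntegrand {n : ℕ} (l t : ℝ)
    (f : (Fin n → ℝ) × (Fin n → ℝ) → ℂ) (zw : (Fin n → ℂ) × (Fin n → ℂ))
    (q : (Fin n → ℝ) × (Fin n → ℝ)) : ℂ :=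
  f q * heatKerC l t (zw.1 - toC q.1) (zw.2 - toC q.2) *
    Complex.exp (-(Complex.I * (l / 2 : ℝ) * (zw.2 ⬝ᵥ toC q.1 - zw.1 ⬝ᵥ toC q.2)))

/-- The function `f *_λ p_t^λ` on `ℂ²ⁿ`. -/
noncomputable def transform {n : ℕ} (l t : ℝ) (f : (Fin n → ℝ) × (Fin n → ℝ) → ℂ)
    (zw : (Fin n → ℂ) × (Fin n → ℂ)) : ℂ :=
  ∫ q : (Fin n → ℝ) × (Fin n → ℝ), transformIntegrand l t f zw q

/-- The weight `W_t^λ(x+iy, u+iv) = e^{λ(u·y - v·x)} p_{2t}^λ(2y, 2v)`. -/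
noncomputable def weight {n : ℕ} (l t : ℝ) (x u y v : Fin n → ℝ) : ℝ :=
  Real.exp (l * (u ⬝ᵥ y - v ⬝ᵥ x)) * heatKer l (2 * t) ((2 : ℝ) • y) ((2 : ℝ) • v)

/-- `|G(z,w)|² W_t^{-4πk}(z,w)` at `z = x+iy`, `w = u+iv`, as a function of `((x,u),(y,v))`. -/
noncomputable def bergDensity {n : ℕ} (k : ℤ) (t : ℝ) (G : (Fin n → ℂ) × (Fin n → ℂ) → ℂ)
    (p : ((Fin n → ℝ) × (Fin n → ℝ)) × ((Fin n → ℝ) × (Fin n → ℝ))) : ℝ :=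
  ‖G (cplx p.1.1 p.2.1, cplx p.1.2 p.2.2)‖ ^ 2 *
    weight (-(4 * Real.pi * k)) t p.1.1 p.1.2 p.2.1 p.2.2

theorem heatKer_nonneg {n : ℕ} (l t : ℝ) (ht : 0 ≤ t) (x u : Fin n → ℝ) :
    0 ≤ heatKer l t x u := by
  have h : 0 ≤ l / Real.sinh (l * t) := by
    rcases le_total 0 l with h | h
    · exact div_nonneg h (Real.sinh_nonneg_iff.2 (mul_nonneg h ht))
    · exact div_nonneg_of_nonpos h (Real.sinh_nonpos_iff.2 (mul_nonpos_of_nonpos_of_nonneg h ht))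
  unfold heatKer
  positivity

theorem continuous_weight {n : ℕ} (l t : ℝ) : Continuous
    (fun p : ((Fin n → ℝ) × (Fin n → ℝ)) × ((Fin n → ℝ) × (Fin n → ℝ)) =>
      weight l t p.1.1 p.1.2 p.2.1 p.2.2) := by
  unfold weight heatKer dotProduct
  fun_prop

theorem continuous_bergDensity {n : ℕ} (k : ℤ) (t : ℝ)
    {G : (Fin n → ℂ) × (Fin n → ℂ) → ℂ} (hG : Continuous G) :
    Continuous (bergDensity k t G) := by
  have h : Continuous
      (fun p : ((Fin n → ℝ) × (Fin n → ℝ)) × ((Fin n → ℝ) × (Fin n → ℝ)) =>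
        (cplx p.1.1 p.2.1, cplx p.1.2 p.2.2)) := by
    unfold cplx
    fun_prop
  exact ((hG.comp h).norm.pow 2).mul (continuous_weight _ t)

/-- The space `B_{t,Γ}^{4πk}` of entire functions `G` on `ℂ²ⁿ` with
`G(z+m, w+m') = e^{2πik(w·m - z·m')} G(z,w)` for `m, m' ∈ ℤⁿ` that are square integrable over
`{(x+iy, u+iv) : (x,u) ∈ [0,1)²ⁿ, (y,v) ∈ ℝ²ⁿ}` with respect to `W_t^{-4πk}`. -/
noncomputable def spaceB (n : ℕ) (k : ℤ) (t : ℝ) (ht : 0 < t) :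
    Submodule ℂ ((Fin n → ℂ) × (Fin n → ℂ) → ℂ) where
  carrier := {G | Differentiable ℂ G ∧
    (∀ (z w : Fin n → ℂ) (m m' : Fin n → ℤ),
      G (z + fun i => (m i : ℂ), w + fun i => (m' i : ℂ)) =
        Complex.exp (2 * Real.pi * Complex.I * k *
          (w ⬝ᵥ (fun i => (m i : ℂ)) - z ⬝ᵥ (fun i => (m' i : ℂ)))) * G (z, w)) ∧
    IntegrableOn (bergDensity k t G) (unitCube n ×ˢ Set.univ)}
  zero_mem' := by
    refine ⟨differentiable_const 0, by simp, ?_⟩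
    have : bergDensity k t (0 : (Fin n → ℂ) × (Fin n → ℂ) → ℂ) = 0 := by
      ext p; simp [bergDensity]
    rw [this]
    exact integrableOn_zero
  add_mem' := by
    rintro F G ⟨h1, h2, h3⟩ ⟨g1, g2, g3⟩
    refine ⟨h1.add g1, fun z w m m' => ?_, ?_⟩
    · simp only [Pi.add_apply, mul_add]
      rw [h2, g2]
    · refine Integrable.mono' ((h3.add g3).const_mul 2)
        (continuous_bergDensity k t (h1.add g1).continuous).aestronglyMeasurable
        (Filter.Eventually.of_forall fun p => ?_)
      have hw : 0 ≤ weight (-(4 * Real.pi * k)) t p.1.1 p.1.2 p.2.1 p.2.2 :=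
        mul_nonneg (Real.exp_pos _).le (heatKer_nonneg _ _ (by positivity) _ _)
      simp only [bergDensity, Pi.add_apply]
      rw [Real.norm_of_nonneg (mul_nonneg (by positivity) hw), ← add_mul, ← mul_assoc]
      refine mul_le_mul_of_nonneg_right ?_ hw
      set a := F (cplx p.1.1 p.2.1, cplx p.1.2 p.2.2)
      set b := G (cplx p.1.1 p.2.1, cplx p.1.2 p.2.2)
      nlinarith [norm_add_le a b, norm_nonneg (a + b), norm_nonneg a, norm_nonneg b,
        sq_nonneg (‖a‖ - ‖b‖)]
  smul_mem' := by
    rintro c F ⟨h1, h2, h3⟩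
    refine ⟨h1.const_smul c, fun z w m m' => ?_, ?_⟩
    · simp only [Pi.smul_apply, smul_eq_mul]
      rw [h2]
      ring
    · have : bergDensity k t (c • F) = fun p => ‖c‖ ^ 2 * bergDensity k t F p := by
        ext p
        simp only [bergDensity, Pi.smul_apply, smul_eq_mul, norm_mul]
        ring
      rw [this]
      exact Integrable.const_mul h3 _

/-- The norm of `B_{t,Γ}^{4πk}`. With `c_n = (4π)⁻ⁿ`, the factor `4ⁿ` normalizes the weight
`W_t^{-4πk}`, and `½` is the length of the fibre `ℝ/½ℤ` of `Γ\ℍ` over the torus. -/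
noncomputable def normB {n : ℕ} (k : ℤ) (t : ℝ) (G : (Fin n → ℂ) × (Fin n → ℂ) → ℂ) : ℝ :=
  Real.sqrt (4 ^ n / 2 * ∫ p in unitCube n ×ˢ Set.univ, bergDensity k t G p)

end HeisNil

namespace HeisNil

open scoped Pointwise ComplexConjugate Topology

/-! Fix the imaginary part Y = (y,v). Up to the factor exp((l/2) symp Y q), whose square the
exponential in the weight cancels, the transform at q + iY is a superposition ∫ K_Y(g) τ_g f(q) dg
of twisted translates of f (`transform_cplx`). The τ_g act as a projective unitary representation on
the L² sections over the torus, so ⟨τ_g f, τ_g' f⟩ is a phase times a function of g - g' alone, the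
`correlation`. Expanding the square turns the cube integral at height Y into ∫ correlation(c) Q_Y(c)
dc, with Q_Y a twisted autocorrelation of the Gaussian K_Y (`integral_norm_sq_twist_average`).

A Gaussian integral gives Q_Y(c) = const · e^{A|Y|²} e^{-γ|c|²} e^{-iβ c·Y}
(`integral_shiftKernel_mul_conj`). By hyperbolic duplication formulas the factor p_{2t}(2Y) of the
weight removes e^{A|Y|²} exactly, and β = l / sinh(2lt) > 0. So the weighted cube integral is the
Fourier transform, at frequency βY, of const · e^{-γ|c|²} correlation(c). Integrating it over Y is
Fourier inversion at c = 0, where the correlation is the squared norm of f over the cube. The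
transform is nonnegative, so boundedness of the correlation and its continuity at 0 suffice
(`lintegral_of_fourierPair_nonneg`); the constants multiply to 4⁻ⁿ.

The argument covers every L² section at once, without a density step. The statement for Schwartz
functions is the special case of the section `twistedAvg l f`, once this is known to come from ℋ_k.
-/

/-- The phase space `ℝⁿ × ℝⁿ`. -/
abbrev PhaseSpace (n : ℕ) := (Fin n → ℝ) × (Fin n → ℝ)

variable {n : ℕ}

/-! ### Euclidean and symplectic forms on phase space -/

instance : (volume : Measure (PhaseSpace n)).IsAddHaarMeasure :=
  Measure.prod.instIsAddHaarMeasure _ _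

/-- The squared Euclidean norm on phase space. -/
def sqNorm (q : PhaseSpace n) : ℝ := q.1 ⬝ᵥ q.1 + q.2 ⬝ᵥ q.2

/-- The Euclidean inner product on phase space. -/
def dotPair (q g : PhaseSpace n) : ℝ := q.1 ⬝ᵥ g.1 + q.2 ⬝ᵥ g.2

/-- The symplectic form on phase space. -/
def symp (q g : PhaseSpace n) : ℝ := q.2 ⬝ᵥ g.1 - q.1 ⬝ᵥ g.2

theorem continuous_sqNorm : Continuous (sqNorm : PhaseSpace n → ℝ) := by
  unfold sqNorm dotProduct
  fun_prop

theorem continuous_dotPair :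
    Continuous (fun p : PhaseSpace n × PhaseSpace n => dotPair p.1 p.2) := by
  unfold dotPair dotProduct
  fun_prop

theorem continuous_symp :
    Continuous (fun p : PhaseSpace n × PhaseSpace n => symp p.1 p.2) := by
  unfold symp dotProduct
  fun_prop

theorem symp_add_left (q r g : PhaseSpace n) : symp (q + r) g = symp q g + symp r g := by
  simp only [symp, Prod.fst_add, Prod.snd_add, add_dotProduct]; ring

theorem symp_add_right (q g h : PhaseSpace n) : symp q (g + h) = symp q g + symp q h := by
  simp only [symp, Prod.fst_add, Prod.snd_add, dotProduct_add]; ring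

theorem symp_neg_left (q g : PhaseSpace n) : symp (-q) g = -symp q g := by
  simp only [symp, Prod.fst_neg, Prod.snd_neg, neg_dotProduct]; ring

theorem symp_neg_right (q g : PhaseSpace n) : symp q (-g) = -symp q g := by
  simp only [symp, Prod.fst_neg, Prod.snd_neg, dotProduct_neg]; ring

theorem symp_sub_left (q r g : PhaseSpace n) : symp (q - r) g = symp q g - symp r g := by
  rw [sub_eq_add_neg, symp_add_left, symp_neg_left, sub_eq_add_neg]

theorem symp_sub_right (q g h : PhaseSpace n) : symp q (g - h) = symp q g - symp q h := by
  rw [sub_eq_add_neg, symp_add_right, symp_neg_right, sub_eq_add_neg]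

theorem symp_swap (q g : PhaseSpace n) : symp g q = -symp q g := by
  simp only [symp, dotProduct_comm g.1, dotProduct_comm g.2]; ring

theorem symp_self (q : PhaseSpace n) : symp q q = 0 := by
  simp only [symp, dotProduct_comm q.1]; ring

@[simp] theorem symp_zero_right (q : PhaseSpace n) : symp q 0 = 0 := by simp [symp]

@[simp] theorem sqNorm_zero : sqNorm (0 : PhaseSpace n) = 0 := by simp [sqNorm]

theorem dotProduct_self_nonneg' (x : Fin n → ℝ) : 0 ≤ x ⬝ᵥ x :=
  Finset.sum_nonneg fun _ _ => mul_self_nonneg _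

theorem sqNorm_nonneg (q : PhaseSpace n) : 0 ≤ sqNorm q :=
  add_nonneg (dotProduct_self_nonneg' _) (dotProduct_self_nonneg' _)

/-- The ambient norm on `Fin n → ℝ` is the sup norm, while the Gaussians are Euclidean. This
comparison lets Gaussians absorb bounds stated in the ambient norm. -/
theorem norm_sq_le_dotProduct_self (x : Fin n → ℝ) : ‖x‖ ^ 2 ≤ x ⬝ᵥ x := by
  have h : ‖x‖ ≤ Real.sqrt (x ⬝ᵥ x) := by
    refine (pi_norm_le_iff_of_nonneg (Real.sqrt_nonneg _)).2 fun i => ?_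
    refine Real.le_sqrt_of_sq_le ?_
    rw [Real.norm_eq_abs, sq_abs, sq]
    exact Finset.single_le_sum (f := fun i => x i * x i) (fun _ _ => mul_self_nonneg _)
      (Finset.mem_univ i)
  calc ‖x‖ ^ 2 ≤ Real.sqrt (x ⬝ᵥ x) ^ 2 := by gcongr
    _ = _ := Real.sq_sqrt (dotProduct_self_nonneg' x)

theorem norm_sq_le_sqNorm (q : PhaseSpace n) : ‖q‖ ^ 2 ≤ sqNorm q := by
  rcases max_choice ‖q.1‖ ‖q.2‖ with h | h
  · rw [Prod.norm_def, h]
    exact (norm_sq_le_dotProduct_self _).trans (le_add_of_nonneg_right (dotProduct_self_nonneg' _))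
  · rw [Prod.norm_def, h]
    exact (norm_sq_le_dotProduct_self _).trans (le_add_of_nonneg_left (dotProduct_self_nonneg' _))

theorem sqNorm_smul (r : ℝ) (q : PhaseSpace n) : sqNorm (r • q) = r ^ 2 * sqNorm q := by
  simp [sqNorm]; ring

theorem sqNorm_add_le (q c : PhaseSpace n) : sqNorm q ≤ 2 * sqNorm (q + c) + 2 * sqNorm c := by
  have h : ∀ x y : Fin n → ℝ, x ⬝ᵥ x ≤ 2 * ((x + y) ⬝ᵥ (x + y)) + 2 * (y ⬝ᵥ y) := fun x y => by
    simp only [dotProduct, Finset.mul_sum, ← Finset.sum_add_distrib, Pi.add_apply]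
    refine Finset.sum_le_sum fun i _ => ?_
    -- The difference of the two sides is exactly (x + 2y)².
    nlinarith [sq_nonneg (x i + 2 * y i)]
  have h1 := h q.1 c.1
  have h2 := h q.2 c.2
  simp only [sqNorm, Prod.fst_add, Prod.snd_add]
  linarith

theorem ofReal_dotProduct (x y : Fin n → ℝ) : ((x ⬝ᵥ y : ℝ) : ℂ) = toC x ⬝ᵥ toC y := by
  simp [dotProduct, toC]

/-! ### Gaussian integrals with complex linear terms -/

theorem gauss_eq_mul (b : ℂ) (p q : Fin n → ℂ) (g : PhaseSpace n) :
    Complex.exp (-b * (sqNorm g : ℝ) + (p ⬝ᵥ toC g.1 + q ⬝ᵥ toC g.2)) =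
      Complex.exp (-b * ∑ i, (g.1 i : ℂ) ^ 2 + ∑ i, p i * g.1 i) *
      Complex.exp (-b * ∑ i, (g.2 i : ℂ) ^ 2 + ∑ i, q i * g.2 i) := by
  rw [← Complex.exp_add]
  congr 1
  simp only [sqNorm, dotProduct, toC, Complex.ofReal_add, Complex.ofReal_sum, Complex.ofReal_mul,
    sq]
  ring

theorem integrable_gauss {b : ℝ} (hb : 0 < b) (p q : Fin n → ℂ) :
    Integrable (fun g : PhaseSpace n =>
      Complex.exp (-b * (sqNorm g : ℝ) + (p ⬝ᵥ toC g.1 + q ⬝ᵥ toC g.2))) := by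
  simp_rw [gauss_eq_mul]
  have hb' : 0 < (b : ℂ).re := by simpa
  exact (GaussianFourier.integrable_cexp_neg_mul_sum_add hb' p).mul_prod
    (GaussianFourier.integrable_cexp_neg_mul_sum_add hb' q)

theorem integral_gauss {b : ℝ} (hb : 0 < b) (p q : Fin n → ℂ) :
    ∫ g : PhaseSpace n, Complex.exp (-b * (sqNorm g : ℝ) + (p ⬝ᵥ toC g.1 + q ⬝ᵥ toC g.2)) =
      (Real.pi / b) ^ n * Complex.exp ((p ⬝ᵥ p + q ⬝ᵥ q) / (4 * b)) := by
  simp_rw [gauss_eq_mul]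
  have hb' : 0 < (b : ℂ).re := by simpa
  have h0 : (Real.pi / b : ℂ) ≠ 0 :=
    div_ne_zero (by exact_mod_cast Real.pi_ne_zero) (by exact_mod_cast hb.ne')
  rw [Measure.volume_eq_prod, integral_prod_mul
    (fun x : Fin n → ℝ => Complex.exp (-b * ∑ i, (x i : ℂ) ^ 2 + ∑ i, p i * x i))
    (fun x : Fin n → ℝ => Complex.exp (-b * ∑ i, (x i : ℂ) ^ 2 + ∑ i, q i * x i)),
    GaussianFourier.integral_cexp_neg_mul_sum_add hb',
    GaussianFourier.integral_cexp_neg_mul_sum_add hb', mul_mul_mul_comm, ← Complex.cpow_add _ _ h0,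
    ← Complex.exp_add, Fintype.card_fin, add_halves, Complex.cpow_natCast]
  congr 2
  simp only [dotProduct, sq]
  ring

theorem integrable_exp_neg_sqNorm {b : ℝ} (hb : 0 < b) :
    Integrable (fun g : PhaseSpace n => Real.exp (-(b * sqNorm g))) := by
  have h := (integrable_gauss hb (0 : Fin n → ℂ) 0).norm
  simpa [Complex.norm_exp] using h

theorem integral_exp_neg_sqNorm {b : ℝ} (hb : 0 < b) :
    ∫ g : PhaseSpace n, Real.exp (-(b * sqNorm g)) = (Real.pi / b) ^ n := by
  have h := integral_gauss hb (0 : Fin n → ℂ) 0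
  simp only [zero_dotProduct, add_zero, zero_div, Complex.exp_zero, mul_one] at h
  have h2 : ∀ g : PhaseSpace n, Complex.exp (-b * (sqNorm g : ℝ)) =
      ((Real.exp (-(b * sqNorm g)) : ℝ) : ℂ) := fun g => by simp
  simp_rw [h2, integral_complex_ofReal] at h
  exact_mod_cast h

/-- Completing the square: half of the Gaussian absorbs any linear exponential growth. -/
theorem exp_neg_sqNorm_add_norm_le {b : ℝ} (hb : 0 < b) (M : ℝ) (g : PhaseSpace n) :
    Real.exp (-(b * sqNorm g) + M * ‖g‖) ≤
      Real.exp (M ^ 2 / (2 * b)) * Real.exp (-(b / 2 * sqNorm g)) := by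
  rw [← Real.exp_add, Real.exp_le_exp]
  have h1 := norm_sq_le_sqNorm g
  have h2 : M * ‖g‖ ≤ M ^ 2 / (2 * b) + b / 2 * ‖g‖ ^ 2 := by
    have : M ^ 2 / (2 * b) + b / 2 * ‖g‖ ^ 2 - M * ‖g‖ = (M - b * ‖g‖) ^ 2 / (2 * b) := by
      field_simp; ring
    have h3 : 0 ≤ (M - b * ‖g‖) ^ 2 / (2 * b) := by positivity
    linarith
  nlinarith

/-! ### The integer lattice and its fundamental domains -/

/-- The inclusion `ℤⁿ × ℤⁿ → ℝⁿ × ℝⁿ`. -/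
def intEmb (n : ℕ) : (Fin n → ℤ) × (Fin n → ℤ) →+ PhaseSpace n where
  toFun m := (fun i => (m.1 i : ℝ), fun i => (m.2 i : ℝ))
  map_zero' := by ext <;> simp
  map_add' := by intro a b; ext <;> simp

/-- The lattice `ℤⁿ × ℤⁿ` in phase space. -/
def intLattice (n : ℕ) : AddSubgroup (PhaseSpace n) := (intEmb n).range

instance : Countable (intLattice n) := (Set.countable_range (intEmb n)).to_subtype

theorem measurableSet_unitCube : MeasurableSet (unitCube n) := by
  have : unitCube n = (Set.univ.pi fun _ => Set.Ico (0 : ℝ) 1) ×ˢ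
      (Set.univ.pi fun _ => Set.Ico (0 : ℝ) 1) := by
    ext q; simp [unitCube]
  rw [this]
  exact (MeasurableSet.univ_pi fun _ => measurableSet_Ico).prod
    (MeasurableSet.univ_pi fun _ => measurableSet_Ico)

theorem unitCube_subset_Icc : unitCube n ⊆ Set.Icc 0 1 := fun _ hq =>
  ⟨⟨fun i => (hq.1 i).1, fun i => (hq.2 i).1⟩, fun i => (hq.1 i).2.le, fun i => (hq.2 i).2.le⟩

theorem volume_unitCube_lt_top : volume (unitCube n) < ⊤ :=
  (measure_mono unitCube_subset_Icc).trans_lt isCompact_Icc.measure_lt_top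

instance : IsFiniteMeasure (volume.restrict (unitCube n)) :=
  ⟨by rw [Measure.restrict_apply_univ]; exact volume_unitCube_lt_top⟩

theorem norm_le_one_of_mem_unitCube {q : PhaseSpace n} (hq : q ∈ unitCube n) : ‖q‖ ≤ 1 := by
  refine max_le ?_ ?_ <;> refine (pi_norm_le_iff_of_nonneg zero_le_one).2 fun i => ?_
  · rw [Real.norm_of_nonneg (hq.1 i).1]; exact (hq.1 i).2.le
  · rw [Real.norm_of_nonneg (hq.2 i).1]; exact (hq.2 i).2.le

theorem exists_unique_int_add_mem_Ico (x : ℝ) : ∃! m : ℤ, (m : ℝ) + x ∈ Set.Ico (0 : ℝ) 1 := by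
  refine ⟨-⌊x⌋, ?_, fun m hm => ?_⟩
  · have h1 := Int.floor_le x
    have h2 := Int.lt_floor_add_one x
    simp only [Int.cast_neg, Set.mem_Ico]
    constructor <;> linarith
  · have : ⌊x⌋ = -m := by
      rw [Int.floor_eq_iff]
      simp only [Set.mem_Ico] at hm
      push_cast
      constructor <;> linarith [hm.1, hm.2]
    omega

theorem isAddFundamentalDomain_unitCube :
    IsAddFundamentalDomain (intLattice n) (unitCube n) volume := by
  refine IsAddFundamentalDomain.mk' measurableSet_unitCube.nullMeasurableSet fun q => ?_
  choose a ha ha' using fun i => exists_unique_int_add_mem_Ico (q.1 i)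
  choose b hb hb' using fun i => exists_unique_int_add_mem_Ico (q.2 i)
  refine ⟨⟨intEmb n (a, b), ⟨(a, b), rfl⟩⟩, ⟨ha, hb⟩, ?_⟩
  rintro ⟨_, ⟨m, rfl⟩⟩ hm
  refine Subtype.ext (congrArg (intEmb n) ?_)
  ext i
  · exact ha' i _ (hm.1 i)
  · exact hb' i _ (hm.2 i)

theorem isAddFundamentalDomain_vadd_unitCube (c : PhaseSpace n) :
    IsAddFundamentalDomain (intLattice n) (c +ᵥ unitCube n) volume := by
  have : VAddCommClass (PhaseSpace n) (intLattice n) (PhaseSpace n) :=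
    ⟨fun a b x => by
      change a + ((b : PhaseSpace n) + x) = (b : PhaseSpace n) + (a + x)
      abel⟩
  exact isAddFundamentalDomain_unitCube.vadd_of_comm c

theorem preimage_add_vadd (c : PhaseSpace n) (s : Set (PhaseSpace n)) :
    (fun q => c + q) ⁻¹' (c +ᵥ s) = s := by
  ext q
  exact Set.vadd_mem_vadd_set_iff (a := c)

/-- The substitution moves the cube to a translate of it. Both are fundamental domains of the
lattice, and a periodic function has the same integral over any two of these. -/
theorem setLIntegral_unitCube_add {h : PhaseSpace n → ENNReal}
    (hh : ∀ q m, h (q + intEmb n m) = h q) (c : PhaseSpace n) :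
    ∫⁻ q in unitCube n, h (q + c) = ∫⁻ q in unitCube n, h q := by
  have h1 := (measurePreserving_add_left (volume : Measure (PhaseSpace n))
    c).setLIntegral_comp_preimage_emb (measurableEmbedding_addLeft c) h (c +ᵥ unitCube n)
  rw [preimage_add_vadd] at h1
  simp_rw [add_comm _ c]
  rw [h1]
  refine IsAddFundamentalDomain.setLIntegral_eq (isAddFundamentalDomain_vadd_unitCube c)
    isAddFundamentalDomain_unitCube h ?_
  rintro ⟨_, m, rfl⟩ q
  change h (intEmb n m + q) = h q
  rw [add_comm, hh]

theorem setIntegral_unitCube_add {h : PhaseSpace n → ℂ}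
    (hh : ∀ q m, h (q + intEmb n m) = h q) (c : PhaseSpace n) :
    ∫ q in unitCube n, h (q + c) = ∫ q in unitCube n, h q := by
  have h1 := (measurePreserving_add_left (volume : Measure (PhaseSpace n))
    c).setIntegral_preimage_emb (measurableEmbedding_addLeft c) h (c +ᵥ unitCube n)
  rw [preimage_add_vadd] at h1
  simp_rw [add_comm _ c]
  rw [h1]
  refine IsAddFundamentalDomain.setIntegral_eq (isAddFundamentalDomain_vadd_unitCube c)
    isAddFundamentalDomain_unitCube (f := h) ?_
  rintro ⟨_, m, rfl⟩ q
  change h (intEmb n m + q) = h q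
  rw [add_comm, hh]

/-! ### Sections, twisted translations and Gaussian integrability -/

/-- The unimodular number `e^{ir}`. -/
noncomputable def unitPhase (r : ℝ) : ℂ := Complex.exp (r * Complex.I)

@[simp] theorem norm_unitPhase (r : ℝ) : ‖unitPhase r‖ = 1 := Complex.norm_exp_ofReal_mul_I r

@[simp] theorem enorm_unitPhase (r : ℝ) : ‖unitPhase r‖ₑ = 1 := by
  rw [← ofReal_norm, norm_unitPhase, ENNReal.ofReal_one]

@[simp] theorem unitPhase_zero : unitPhase 0 = 1 := by simp [unitPhase]

theorem unitPhase_add (r s : ℝ) : unitPhase (r + s) = unitPhase r * unitPhase s := by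
  simp only [unitPhase, ← Complex.exp_add]; push_cast; ring_nf

theorem conj_unitPhase (r : ℝ) : (starRingEnd ℂ) (unitPhase r) = unitPhase (-r) := by
  simp [unitPhase, ← Complex.exp_conj]

theorem continuous_unitPhase : Continuous unitPhase := by
  unfold unitPhase
  fun_prop

/-- Square integrable sections over the torus of the line bundle with multiplier
`e^{-i(l/2) ω(q,m)}`, as functions on phase space. -/
structure IsSection (l : ℝ) (f : PhaseSpace n → ℂ) : Prop where
  quasi : ∀ q m, f (q + intEmb n m) = unitPhase (-(l / 2 * symp q (intEmb n m))) * f q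
  memLp : MemLp f 2 (volume.restrict (unitCube n))

/-- The twisted translation by `g`. -/
noncomputable def twist (l : ℝ) (g : PhaseSpace n) (f : PhaseSpace n → ℂ) (q : PhaseSpace n) : ℂ :=
  unitPhase (l / 2 * symp q g) * f (q - g)

@[simp] theorem norm_twist (l : ℝ) (g : PhaseSpace n) (f : PhaseSpace n → ℂ) (q : PhaseSpace n) :
    ‖twist l g f q‖ = ‖f (q - g)‖ := by simp [twist]

theorem exp_neg_sqNorm_add_le {b : ℝ} (hb : 0 < b) (q c : PhaseSpace n) :
    Real.exp (-(b * sqNorm (q + c))) ≤ Real.exp (b * sqNorm c) *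
      Real.exp (-(b / 2 * sqNorm q)) := by
  rw [← Real.exp_add, Real.exp_le_exp]
  nlinarith [sqNorm_add_le q c]

theorem exists_sqNorm_le_of_mem_unitCube (n : ℕ) :
    ∃ R : ℝ, ∀ c ∈ unitCube n, sqNorm c ≤ R := by
  obtain ⟨R, hR⟩ := isCompact_Icc.exists_bound_of_continuousOn
    (s := Set.Icc (0 : PhaseSpace n) 1) continuous_sqNorm.continuousOn
  exact ⟨R, fun c hc => (le_abs_self _).trans (hR c (unitCube_subset_Icc hc))⟩

theorem volume_unitCube_ne_zero : volume (unitCube n) ≠ 0 := by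
  have : VAddInvariantMeasure (intLattice n) (PhaseSpace n) volume :=
    ⟨fun c s _ => measure_preimage_add volume (c : PhaseSpace n) s⟩
  exact isAddFundamentalDomain_unitCube.measure_ne_zero (NeZero.ne _)

/-- Averaging trick: the integral J is invariant under translation by c, so J · vol(cube) is its
average over c in the cube. The Gaussian is dominated uniformly in such c, and after Tonelli the
inner integral of φ(q + c) over c does not depend on q by periodicity. -/
theorem lintegral_periodic_mul_exp_lt_top {φ : PhaseSpace n → ENNReal} (hφ : AEMeasurable φ)
    (hper : ∀ q m, φ (q + intEmb n m) = φ q) (hfin : ∫⁻ q in unitCube n, φ q < ⊤)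
    {b : ℝ} (hb : 0 < b) :
    ∫⁻ q, φ q * ENNReal.ofReal (Real.exp (-(b * sqNorm q))) < ⊤ := by
  set J := ∫⁻ q, φ q * ENNReal.ofReal (Real.exp (-(b * sqNorm q))) with hJ
  obtain ⟨R, hR⟩ := exists_sqNorm_le_of_mem_unitCube n
  let w : PhaseSpace n → ENNReal := fun q =>
    ENNReal.ofReal (Real.exp (b * R) * Real.exp (-(b / 2 * sqNorm q)))
  have hw : Measurable w := by
    have := (continuous_sqNorm (n := n)).measurable
    fun_prop
  have hle : J * volume (unitCube n) ≤ (∫⁻ q, w q) * ∫⁻ q in unitCube n, φ q := by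
    calc J * volume (unitCube n) = ∫⁻ _ in unitCube n, J := by rw [setLIntegral_const]
      _ = ∫⁻ c in unitCube n, ∫⁻ q : PhaseSpace n,
            φ (q + c) * ENNReal.ofReal (Real.exp (-(b * sqNorm (q + c)))) := by
          refine lintegral_congr fun c => ?_
          rw [hJ, lintegral_add_right_eq_self
            (fun q => φ q * ENNReal.ofReal (Real.exp (-(b * sqNorm q)))) c]
      _ ≤ ∫⁻ c in unitCube n, ∫⁻ q : PhaseSpace n, w q * φ (q + c) := by
          refine setLIntegral_mono' measurableSet_unitCube fun c hc =>
            lintegral_mono fun q => ?_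
          rw [mul_comm]
          gcongr
          refine ENNReal.ofReal_le_ofReal ((exp_neg_sqNorm_add_le hb q c).trans ?_)
          gcongr
          exact hR c hc
      _ = ∫⁻ q : PhaseSpace n, ∫⁻ c in unitCube n, w q * φ (q + c) := by
          refine lintegral_lintegral_swap ?_
          refine AEMeasurable.mul (hw.comp measurable_snd).aemeasurable ?_
          have hq : Measure.QuasiMeasurePreserving (fun p : PhaseSpace n × PhaseSpace n =>
              p.2 + p.1) (volume.prod volume) volume := by
            simp_rw [add_comm]
            exact quasiMeasurePreserving_add volume volume
          exact (hφ.comp_quasiMeasurePreserving hq).mono_ac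
            (Measure.restrict_le_self.absolutelyContinuous.prod
              Measure.AbsolutelyContinuous.rfl)
      _ = ∫⁻ q : PhaseSpace n, w q * ∫⁻ c in unitCube n, φ c := by
          refine lintegral_congr fun q => ?_
          rw [lintegral_const_mul' _ _ ENNReal.ofReal_ne_top]
          simp_rw [add_comm q]
          rw [setLIntegral_unitCube_add hper q]
      _ = _ := lintegral_mul_const _ hw
  have hwfin : (∫⁻ q, w q) < ⊤ :=
    ((integrable_exp_neg_sqNorm (n := n) (half_pos hb)).const_mul
      (Real.exp (b * R))).lintegral_lt_top
  rcases ENNReal.mul_lt_top_iff.1 (hle.trans_lt (ENNReal.mul_lt_top hwfin hfin)) with h | h | h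
  · exact h.1
  · rw [h]; exact ENNReal.zero_lt_top
  · exact absurd h volume_unitCube_ne_zero

namespace IsSection

variable {l : ℝ} {f : PhaseSpace n → ℂ}

theorem norm_periodic (hf : IsSection l f) (q : PhaseSpace n) (m) :
    ‖f (q + intEmb n m)‖ = ‖f q‖ := by
  rw [hf.quasi, norm_mul, norm_unitPhase, one_mul]

theorem enorm_periodic (hf : IsSection l f) (q : PhaseSpace n) (m) :
    ‖f (q + intEmb n m)‖ₑ = ‖f q‖ₑ := by
  rw [← ofReal_norm, ← ofReal_norm, hf.norm_periodic]

/-- The phase symp m g produced by the twist cancels the symp g m in the multiplier: twisted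
translations commute with the lattice action, as right translations do with left ones. No
integrality of g or l enters. -/
theorem twist_quasi (hf : IsSection l f) (g q : PhaseSpace n) (m) :
    twist l g f (q + intEmb n m) =
      unitPhase (-(l / 2 * symp q (intEmb n m))) * twist l g f q := by
  rw [twist, add_sub_right_comm, hf.quasi, twist, ← mul_assoc, ← mul_assoc, ← unitPhase_add,
    ← unitPhase_add]
  congr 2
  rw [symp_add_left, symp_sub_left, symp_swap (intEmb n m) g]
  ring

/-- Measurability is given on the cube only. On each of the countably many lattice translates f is a
continuous phase times its values on the cube. -/
theorem aestronglyMeasurable (hf : IsSection l f) : AEStronglyMeasurable f volume := by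
  rw [← isAddFundamentalDomain_unitCube.sum_restrict (μ := (volume : Measure (PhaseSpace n))),
    aestronglyMeasurable_sum_measure_iff]
  rintro ⟨_, m, rfl⟩
  have h1 := ((measurePreserving_add_left (volume : Measure (PhaseSpace n))
    (intEmb n m)).restrict_preimage_emb (measurableEmbedding_addLeft _)
    (intEmb n m +ᵥ unitCube n))
  rw [preimage_add_vadd] at h1
  refine (h1.aestronglyMeasurable_comp_iff (measurableEmbedding_addLeft _)).1 ?_
  have h2 : (f ∘ fun q => intEmb n m + q) =
      fun q => unitPhase (-(l / 2 * symp q (intEmb n m))) * f q := by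
    ext q
    rw [Function.comp_apply, add_comm, hf.quasi]
  rw [h2]
  refine Continuous.aestronglyMeasurable ?_ |>.mul hf.memLp.1
  exact continuous_unitPhase.comp
    (continuous_const.mul (continuous_symp.comp (by fun_prop : Continuous
      fun q : PhaseSpace n => (q, intEmb n m)))).neg

theorem lintegral_enorm_lt_top (hf : IsSection l f) : ∫⁻ q in unitCube n, ‖f q‖ₑ < ⊤ :=
  (hf.memLp.integrable one_le_two).2

theorem integrable_mul_exp_neg_sqNorm (hf : IsSection l f) {b : ℝ} (hb : 0 < b) :
    Integrable (fun q => f q * (Real.exp (-(b * sqNorm q)) : ℂ)) := by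
  have hcont : Continuous fun q : PhaseSpace n => Real.exp (-(b * sqNorm q)) :=
    (continuous_const.mul continuous_sqNorm).neg.rexp
  refine ⟨hf.aestronglyMeasurable.mul
    (Complex.continuous_ofReal.comp hcont).aestronglyMeasurable, ?_⟩
  refine lt_of_eq_of_lt (lintegral_congr fun q => ?_) (lintegral_periodic_mul_exp_lt_top
    hf.aestronglyMeasurable.enorm hf.enorm_periodic hf.lintegral_enorm_lt_top hb)
  rw [enorm_mul, ← ofReal_norm ((_ : ℝ) : ℂ), Complex.norm_real,
    Real.norm_of_nonneg (Real.exp_pos _).le]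

theorem integrable_mul_of_norm_le (hf : IsSection l f) {h : PhaseSpace n → ℂ} (hh : Continuous h)
    {b C : ℝ} (hb : 0 < b) (hle : ∀ q, ‖h q‖ ≤ C * Real.exp (-(b * sqNorm q))) :
    Integrable (fun q => f q * h q) := by
  refine ((hf.integrable_mul_exp_neg_sqNorm hb).norm.const_mul C).mono'
    (hf.aestronglyMeasurable.mul hh.aestronglyMeasurable) (Filter.Eventually.of_forall fun q => ?_)
  rw [norm_mul, norm_mul, Complex.norm_real, Real.norm_of_nonneg (Real.exp_pos _).le]
  nlinarith [mul_le_mul_of_nonneg_left (hle q) (norm_nonneg (f q))]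

theorem integrable_mul_cexp (hf : IsSection l f) {h : PhaseSpace n → ℂ} (hh : Continuous h)
    {b M : ℝ} (hb : 0 < b) (hle : ∀ q, ‖h q‖ ≤ M * ‖q‖) :
    Integrable (fun q => f q * Complex.exp (-b * (sqNorm q : ℝ) + h q)) := by
  have := continuous_sqNorm (n := n)
  refine hf.integrable_mul_of_norm_le (by fun_prop) (half_pos hb)
    (C := Real.exp (M ^ 2 / (2 * b))) fun q => ?_
  refine le_trans ?_ (exp_neg_sqNorm_add_norm_le hb M q)
  rw [Complex.norm_exp, Real.exp_le_exp]
  have h1 := (Complex.re_le_norm (h q)).trans (hle q)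
  simpa using h1

/-- Differentiation under the integral sign, with a Gaussian of half the rate as dominating
function. -/
theorem differentiable_integral_cexp (hf : IsSection l f) {V : Type*} [NormedAddCommGroup V]
    [NormedSpace ℂ V] {Λ : PhaseSpace n → V →L[ℂ] ℂ} (hΛ : Continuous Λ) {b M : ℝ} (hb : 0 < b)
    (hle : ∀ q, ‖Λ q‖ ≤ M * ‖q‖) :
    Differentiable ℂ
      (fun v => ∫ q, f q * Complex.exp (-b * (sqNorm q : ℝ) + Λ q v)) := by
  intro v
  have hs := continuous_sqNorm (n := n)
  have hcont : ∀ v, Continuous fun q => Complex.exp (-b * (sqNorm q : ℝ) + Λ q v) := fun v => by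
    have : Continuous fun q => Λ q v := hΛ.clm_apply continuous_const
    fun_prop
  have hle' : ∀ v q, ‖Λ q v‖ ≤ M * ‖v‖ * ‖q‖ := fun v q =>
    ((Λ q).le_opNorm v).trans (by nlinarith [hle q, norm_nonneg v])
  -- The first term bounds the exponent for all v' within distance 1 of v. The second absorbs the
  -- factor ‖Λ q‖ ≤ exp(|M| ‖q‖) of the derivative.
  set N := |M| * (‖v‖ + 1) + |M| with hN
  let bound : PhaseSpace n → ℝ := fun q => ‖f q * ((Real.exp (N ^ 2 / (2 * b)) *
    Real.exp (-(b / 2 * sqNorm q)) : ℝ) : ℂ)‖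
  have hbound : Integrable bound := by
    refine (hf.integrable_mul_of_norm_le ?_ (half_pos hb) (C := Real.exp (N ^ 2 / (2 * b)))
      fun q => ?_).norm
    · fun_prop
    · rw [Complex.norm_real, Real.norm_of_nonneg (by positivity)]
  refine (hasFDerivAt_integral_of_dominated_of_fderiv_le
    (F' := fun v q => (f q * Complex.exp (-b * (sqNorm q : ℝ) + Λ q v)) • Λ q) (bound := bound)
    (Metric.ball_mem_nhds v zero_lt_one) (Filter.Eventually.of_forall fun v =>
      hf.aestronglyMeasurable.mul (hcont v).aestronglyMeasurable)
    (hf.integrable_mul_cexp (hΛ.clm_apply continuous_const) hb (hle' v))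
    ((hf.aestronglyMeasurable.mul (hcont v).aestronglyMeasurable).smul hΛ.aestronglyMeasurable)
    (Filter.Eventually.of_forall fun q v' hv' => ?_) hbound
    (Filter.Eventually.of_forall fun q v' _ => ?_)).differentiableAt
  · have hv : ‖v'‖ ≤ ‖v‖ + 1 := by
      have := norm_le_norm_add_norm_sub' v' v
      rw [mem_ball_iff_norm] at hv'
      linarith
    simp only [bound, norm_smul, norm_mul, mul_assoc]
    refine mul_le_mul_of_nonneg_left ?_ (norm_nonneg _)
    rw [Complex.norm_real, Real.norm_of_nonneg (by positivity)]
    refine le_trans ?_ (exp_neg_sqNorm_add_norm_le hb N q)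
    have hM : ‖Λ q‖ ≤ |M| * ‖q‖ := (hle q).trans (by gcongr; exact le_abs_self M)
    have h1 : ‖Λ q‖ ≤ Real.exp (|M| * ‖q‖) :=
      hM.trans ((le_add_of_nonneg_right zero_le_one).trans (Real.add_one_le_exp _))
    have h2 : ‖Complex.exp (-b * (sqNorm q : ℝ) + Λ q v')‖ ≤
        Real.exp (-(b * sqNorm q) + |M| * (‖v‖ + 1) * ‖q‖) := by
      rw [Complex.norm_exp, Real.exp_le_exp]
      have h3 : (Λ q v').re ≤ |M| * (‖v‖ + 1) * ‖q‖ := by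
        refine (Complex.re_le_norm _).trans (((Λ q).le_opNorm v').trans ?_)
        calc ‖Λ q‖ * ‖v'‖ ≤ |M| * ‖q‖ * (‖v‖ + 1) := by gcongr
          _ = _ := by ring
      simpa using h3
    calc _ ≤ Real.exp (-(b * sqNorm q) + |M| * (‖v‖ + 1) * ‖q‖) * Real.exp (|M| * ‖q‖) := by
          gcongr
      _ = _ := by rw [← Real.exp_add, hN]; ring_nf
  · have h1 : HasFDerivAt (fun v => -(b : ℂ) * (sqNorm q : ℝ) + Λ q v) (Λ q) v' :=
      (Λ q).hasFDerivAt.const_add _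
    have h2 := h1.cexp.const_mul (f q)
    rwa [smul_smul] at h2

end IsSection

/-! ### The transform as a quasi-periodic entire function -/

/-- The exponent `(l/4) coth(lt)` of the kernel `p_t^l`. -/
noncomputable def heatExp (l t : ℝ) : ℝ := l / 4 * (Real.cosh (l * t) / Real.sinh (l * t))

/-- The normalization constant of the kernel `p_t^l`. -/
noncomputable def heatConst (n : ℕ) (l t : ℝ) : ℝ :=
  ((4 * Real.pi) ^ n)⁻¹ * (l / Real.sinh (l * t)) ^ n

theorem div_sinh_pos {l t : ℝ} (hl : l ≠ 0) (ht : 0 < t) : 0 < l / Real.sinh (l * t) := by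
  rcases lt_or_gt_of_ne hl with h | h
  · exact div_pos_of_neg_of_neg h (Real.sinh_neg_iff.2 (mul_neg_of_neg_of_pos h ht))
  · exact div_pos h (Real.sinh_pos_iff.2 (mul_pos h ht))

theorem heatExp_pos {l t : ℝ} (hl : l ≠ 0) (ht : 0 < t) : 0 < heatExp l t := by
  have h : heatExp l t = l / Real.sinh (l * t) * Real.cosh (l * t) / 4 := by
    unfold heatExp; ring
  rw [h]
  have := div_sinh_pos hl ht
  have := Real.cosh_pos (l * t)
  positivity

theorem heatConst_pos {l t : ℝ} (hl : l ≠ 0) (ht : 0 < t) : 0 < heatConst n l t := by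
  have := div_sinh_pos hl ht
  unfold heatConst
  positivity

theorem heatKer_eq (l t : ℝ) (q : PhaseSpace n) :
    heatKer l t q.1 q.2 = heatConst n l t * Real.exp (-(heatExp l t * sqNorm q)) := rfl

theorem heatKerC_eq (l t : ℝ) (z w : Fin n → ℂ) :
    heatKerC l t z w = heatConst n l t * Complex.exp (-(heatExp l t * (z ⬝ᵥ z + w ⬝ᵥ w))) := rfl

/-- For fixed `q`, the linear part in `(z,w)` of the exponent of the integrand of the transform. -/
noncomputable def transformForm (l t : ℝ) (q : PhaseSpace n) :
    ((Fin n → ℂ) × (Fin n → ℂ)) →L[ℂ] ℂ :=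
  ∑ i, ((q.1 i : ℂ) •
      ((2 * heatExp l t : ℂ) • (ContinuousLinearMap.proj (φ := fun _ => ℂ) i).comp
          (ContinuousLinearMap.fst ℂ _ _) -
        (Complex.I * l / 2) • (ContinuousLinearMap.proj (φ := fun _ => ℂ) i).comp
          (ContinuousLinearMap.snd ℂ _ _)) +
    (q.2 i : ℂ) •
      ((2 * heatExp l t : ℂ) • (ContinuousLinearMap.proj (φ := fun _ => ℂ) i).comp
          (ContinuousLinearMap.snd ℂ _ _) +
        (Complex.I * l / 2) • (ContinuousLinearMap.proj (φ := fun _ => ℂ) i).comp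
          (ContinuousLinearMap.fst ℂ _ _)))

theorem continuous_transformForm (l t : ℝ) :
    Continuous (transformForm l t : PhaseSpace n → _) := by
  unfold transformForm
  fun_prop

theorem exists_norm_transformForm_le (n : ℕ) (l t : ℝ) :
    ∃ M : ℝ, ∀ q : PhaseSpace n, ‖transformForm l t q‖ ≤ M * ‖q‖ := by
  refine ⟨∑ i, (‖(2 * heatExp l t : ℂ) • (ContinuousLinearMap.proj (φ := fun _ => ℂ) i).comp
          (ContinuousLinearMap.fst ℂ (Fin n → ℂ) (Fin n → ℂ)) -
        (Complex.I * l / 2) • (ContinuousLinearMap.proj (φ := fun _ => ℂ) i).comp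
          (ContinuousLinearMap.snd ℂ (Fin n → ℂ) (Fin n → ℂ))‖ +
      ‖(2 * heatExp l t : ℂ) • (ContinuousLinearMap.proj (φ := fun _ => ℂ) i).comp
          (ContinuousLinearMap.snd ℂ (Fin n → ℂ) (Fin n → ℂ)) +
        (Complex.I * l / 2) • (ContinuousLinearMap.proj (φ := fun _ => ℂ) i).comp
          (ContinuousLinearMap.fst ℂ (Fin n → ℂ) (Fin n → ℂ))‖), fun q => ?_⟩
  rw [transformForm, Finset.sum_mul]
  refine (norm_sum_le _ _).trans (Finset.sum_le_sum fun i _ => ?_)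
  refine (norm_add_le _ _).trans ?_
  rw [norm_smul, norm_smul, Complex.norm_real, Complex.norm_real, add_mul, mul_comm _ ‖q‖,
    mul_comm _ ‖q‖]
  gcongr
  · exact (norm_le_pi_norm q.1 i).trans (norm_fst_le q)
  · exact (norm_le_pi_norm q.2 i).trans (norm_snd_le q)

theorem transformForm_apply (l t : ℝ) (q : PhaseSpace n) (zw : (Fin n → ℂ) × (Fin n → ℂ)) :
    transformForm l t q zw =
      2 * heatExp l t * (zw.1 ⬝ᵥ toC q.1 + zw.2 ⬝ᵥ toC q.2) -
        Complex.I * l / 2 * (zw.2 ⬝ᵥ toC q.1 - zw.1 ⬝ᵥ toC q.2) := by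
  simp only [transformForm, dotProduct, toC, mul_add, mul_sub, Finset.mul_sum,
    ← Finset.sum_add_distrib, ← Finset.sum_sub_distrib, FunLike.coe_sum, Finset.sum_apply]
  refine Finset.sum_congr rfl fun i _ => ?_
  simp
  ring

theorem ofReal_sqNorm (q : PhaseSpace n) :
    (sqNorm q : ℂ) = toC q.1 ⬝ᵥ toC q.1 + toC q.2 ⬝ᵥ toC q.2 := by
  rw [sqNorm, Complex.ofReal_add, ofReal_dotProduct, ofReal_dotProduct]

theorem sub_dotProduct_self (z x : Fin n → ℂ) :
    (z - x) ⬝ᵥ (z - x) = z ⬝ᵥ z - 2 * (z ⬝ᵥ x) + x ⬝ᵥ x := by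
  simp only [sub_dotProduct, dotProduct_sub, dotProduct_comm x z]; ring

/-- Expanding the square separates a prefactor in (z,w) alone from an exponent that is linear in
(z,w), the shape required by `differentiable_integral_cexp`. -/
theorem transformIntegrand_eq (l t : ℝ) (f : PhaseSpace n → ℂ) (zw : (Fin n → ℂ) × (Fin n → ℂ))
    (q : PhaseSpace n) :
    transformIntegrand l t f zw q =
      heatConst n l t * Complex.exp (-(heatExp l t * (zw.1 ⬝ᵥ zw.1 + zw.2 ⬝ᵥ zw.2))) *
        (f q * Complex.exp (-heatExp l t * (sqNorm q : ℝ) + transformForm l t q zw)) := by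
  rw [transformIntegrand, heatKerC_eq, transformForm_apply, ofReal_sqNorm, sub_dotProduct_self,
    sub_dotProduct_self]
  rw [mul_assoc (f q), mul_assoc (heatConst n l t : ℂ), ← Complex.exp_add, mul_left_comm,
    mul_assoc (heatConst n l t : ℂ), mul_left_comm (Complex.exp _) (f q), ← Complex.exp_add]
  congr 3
  push_cast
  ring

namespace IsSection

variable {l t : ℝ} {f : PhaseSpace n → ℂ}

theorem integrable_transformIntegrand (hf : IsSection l f) (hl : l ≠ 0) (ht : 0 < t)
    (zw : (Fin n → ℂ) × (Fin n → ℂ)) : Integrable (transformIntegrand l t f zw) := by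
  obtain ⟨M, hM⟩ := exists_norm_transformForm_le n l t
  have h := hf.integrable_mul_cexp ((continuous_transformForm (n := n) l t).clm_apply
    (continuous_const (y := zw))) (M := M * ‖zw‖) (heatExp_pos hl ht) fun q =>
      ((transformForm l t q).le_opNorm zw).trans (by nlinarith [hM q, norm_nonneg zw])
  exact (h.const_mul _).congr
    (Filter.Eventually.of_forall fun q => (transformIntegrand_eq l t f zw q).symm)

theorem differentiable_transform (hf : IsSection l f) (hl : l ≠ 0) (ht : 0 < t) :
    Differentiable ℂ (transform l t f) := by
  obtain ⟨M, hM⟩ := exists_norm_transformForm_le n l t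
  have h := hf.differentiable_integral_cexp (continuous_transformForm l t) (heatExp_pos hl ht) hM
  have h2 : transform l t f = fun zw =>
      heatConst n l t * Complex.exp (-(heatExp l t * (zw.1 ⬝ᵥ zw.1 + zw.2 ⬝ᵥ zw.2))) *
        ∫ q, f q * Complex.exp (-heatExp l t * (sqNorm q : ℝ) + transformForm l t q zw) := by
    ext zw
    simp_rw [transform, transformIntegrand_eq, integral_const_mul]
  rw [h2]
  refine Differentiable.mul ?_ h
  unfold dotProduct
  fun_prop

/-- Shifting the integration variable by the same lattice vector leaves the kernel argument z - q
unchanged; only the multiplier of f and the twisting phase contribute. -/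
theorem transform_quasi (hf : IsSection l f) (z w : Fin n → ℂ) (m m' : Fin n → ℤ) :
    transform l t f (z + fun i => (m i : ℂ), w + fun i => (m' i : ℂ)) =
      Complex.exp (-(Complex.I * l / 2 *
        (w ⬝ᵥ (fun i => (m i : ℂ)) - z ⬝ᵥ (fun i => (m' i : ℂ))))) * transform l t f (z, w) := by
  rw [transform, transform, ← integral_add_right_eq_self _ (intEmb n (m, m')),
    ← integral_const_mul]
  congr 1 with q
  have h1 : toC (q + intEmb n (m, m')).1 = toC q.1 + fun i => (m i : ℂ) := by
    ext i; simp [toC, intEmb]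
  have h2 : toC (q + intEmb n (m, m')).2 = toC q.2 + fun i => (m' i : ℂ) := by
    ext i; simp [toC, intEmb]
  have h3 : (symp q (intEmb n (m, m')) : ℂ) =
      toC q.2 ⬝ᵥ (fun i => (m i : ℂ)) - toC q.1 ⬝ᵥ (fun i => (m' i : ℂ)) := by
    rw [symp, Complex.ofReal_sub, ofReal_dotProduct, ofReal_dotProduct]
    congr 2
  rw [transformIntegrand, transformIntegrand, hf.quasi, h1, h2, add_sub_add_right_eq_sub,
    add_sub_add_right_eq_sub, unitPhase]
  generalize heatKerC l t _ _ = A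
  generalize f q = B
  have h4 : ∀ a c d e : ℂ, a * c = d * e → a * B * A * c = d * (B * A * e) := fun a c d e h => by
    linear_combination A * B * h
  refine h4 _ _ _ _ ?_
  rw [← Complex.exp_add, ← Complex.exp_add]
  congr 1
  push_cast
  rw [h3]
  simp only [add_dotProduct, dotProduct_add]
  rw [dotProduct_comm (fun i => (m' i : ℂ)) (toC q.1), dotProduct_comm (fun i => (m i : ℂ))
    (toC q.2), dotProduct_comm (fun i => (m' i : ℂ)) (fun i => (m i : ℂ))]
  ring

end IsSection

/-! ### Matrix coefficients of twisted translations -/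

/-- The matrix coefficient `⟨τ_c f, f⟩` of the twisted translations on the unit cube. -/
noncomputable def correlation (l : ℝ) (f : PhaseSpace n → ℂ) (c : PhaseSpace n) : ℂ :=
  ∫ q in unitCube n, twist l c f q * conj (f q)

theorem mul_le_sq_add_sq_ennreal (a b : ENNReal) : a * b ≤ a ^ 2 + b ^ 2 := by
  rcases le_total a b with h | h
  · exact (mul_le_mul_left h b).trans (by rw [← sq]; exact le_add_self)
  · exact (mul_le_mul_right h a).trans (by rw [← sq]; exact le_self_add)

namespace IsSection

variable {l : ℝ} {f : PhaseSpace n → ℂ}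

theorem lintegral_enorm_sq_lt_top (hf : IsSection l f) : ∫⁻ q in unitCube n, ‖f q‖ₑ ^ 2 < ⊤ := by
  have h := lintegral_rpow_enorm_lt_top_of_eLpNorm_lt_top two_ne_zero ENNReal.ofNat_ne_top
    hf.memLp.2
  simpa using h

theorem lintegral_sub (hf : IsSection l f) (g : PhaseSpace n) :
    ∫⁻ q in unitCube n, ‖f (q - g)‖ₑ ^ 2 = ∫⁻ q in unitCube n, ‖f q‖ₑ ^ 2 := by
  simp_rw [sub_eq_add_neg]
  exact setLIntegral_unitCube_add (h := fun q => ‖f q‖ₑ ^ 2)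
    (fun q m => by rw [hf.enorm_periodic]) (-g)

theorem aestronglyMeasurable_comp_sub (hf : IsSection l f) (g : PhaseSpace n) :
    AEStronglyMeasurable (fun q => f (q - g)) :=
  hf.aestronglyMeasurable.comp_quasiMeasurePreserving
    (measurePreserving_sub_right volume g).quasiMeasurePreserving

/-- The bound is uniform in g and g', which gives both the boundedness of the correlation and the
Fubini hypothesis below. -/
theorem lintegral_mul_le (hf : IsSection l f) (g g' : PhaseSpace n) :
    ∫⁻ q in unitCube n, ‖f (q - g)‖ₑ * ‖f (q - g')‖ₑ ≤
      2 * ∫⁻ q in unitCube n, ‖f q‖ₑ ^ 2 := by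
  calc ∫⁻ q in unitCube n, ‖f (q - g)‖ₑ * ‖f (q - g')‖ₑ
      ≤ ∫⁻ q in unitCube n, (‖f (q - g)‖ₑ ^ 2 + ‖f (q - g')‖ₑ ^ 2) :=
        lintegral_mono fun q => mul_le_sq_add_sq_ennreal _ _
    _ = _ := by
        rw [lintegral_add_left' ((hf.aestronglyMeasurable_comp_sub g).restrict.enorm.pow_const _),
          hf.lintegral_sub, hf.lintegral_sub, two_mul]

theorem norm_correlation_le (hf : IsSection l f) :
    ∃ B : ℝ, ∀ c, ‖correlation l f c‖ ≤ B := by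
  refine ⟨(2 * ∫⁻ q in unitCube n, ‖f q‖ₑ ^ 2).toReal, fun c => ?_⟩
  rw [← toReal_enorm]
  refine ENNReal.toReal_mono
    (ENNReal.mul_ne_top ENNReal.ofNat_ne_top hf.lintegral_enorm_sq_lt_top.ne) ?_
  refine (enorm_integral_le_lintegral_enorm _).trans (le_trans (le_of_eq ?_)
    (hf.lintegral_mul_le c 0))
  refine lintegral_congr fun q => ?_
  simp [twist, enorm_mul]

/-- Projective unitarity. The two multipliers are conjugate, so the product is periodic and the cube
may be shifted by g'; the cocycle identity for symp then leaves a phase independent of q. -/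
theorem integral_twist_mul_conj_twist (hf : IsSection l f) (g g' : PhaseSpace n) :
    ∫ q in unitCube n, twist l g f q * conj (twist l g' f q) =
      unitPhase (l / 2 * symp g' g) * correlation l f (g - g') := by
  rw [← setIntegral_unitCube_add (h := fun q => twist l g f q * conj (twist l g' f q)) ?_ g',
    correlation, ← integral_const_mul]
  · refine integral_congr_ae (Filter.Eventually.of_forall fun q => ?_)
    have h1 : unitPhase (l / 2 * symp (q + g') g) * unitPhase (-(l / 2 * symp (q + g') g')) =
        unitPhase (l / 2 * symp g' g) * unitPhase (l / 2 * symp q (g - g')) := by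
      rw [← unitPhase_add, ← unitPhase_add, symp_add_left, symp_add_left, symp_sub_right, symp_self]
      ring_nf
    simp only [twist, map_mul, conj_unitPhase, add_sub_cancel_right]
    rw [show q + g' - g = q - (g - g') by abel]
    linear_combination f (q - (g - g')) * conj (f q) * h1
  · intro q m
    simp only [hf.twist_quasi, map_mul, conj_unitPhase]
    have h1 : unitPhase (-(l / 2 * symp q (intEmb n m))) *
        unitPhase (- -(l / 2 * symp q (intEmb n m))) = 1 := by
      rw [← unitPhase_add, add_neg_cancel, unitPhase_zero]
    linear_combination twist l g f q * conj (twist l g' f q) * h1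

theorem aestronglyMeasurable_twist (hf : IsSection l f) :
    AEStronglyMeasurable (fun p : PhaseSpace n × PhaseSpace n => twist l p.2 f p.1)
      (volume.prod volume) := by
  refine Continuous.aestronglyMeasurable ?_ |>.mul
    (hf.aestronglyMeasurable.comp_quasiMeasurePreserving
      (quasiMeasurePreserving_sub_of_right_invariant volume volume))
  exact continuous_unitPhase.comp (continuous_const.mul continuous_symp)

theorem aestronglyMeasurable_twist_mul (hf : IsSection l f) :
    AEStronglyMeasurable (fun p : PhaseSpace n × PhaseSpace n × PhaseSpace n =>
      twist l p.2.1 f p.1 * conj (twist l p.2.2 f p.1))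
      ((volume.restrict (unitCube n)).prod (volume.prod volume)) := by
  have h1 : Measure.QuasiMeasurePreserving
      (fun p : PhaseSpace n × PhaseSpace n × PhaseSpace n => (p.1, p.2.1))
      (volume.prod (volume.prod volume)) (volume.prod volume) :=
    Measure.quasiMeasurePreserving_fst.comp
      (measurePreserving_prodAssoc volume volume volume).symm.quasiMeasurePreserving
  have h2 : Measure.QuasiMeasurePreserving
      (fun p : PhaseSpace n × PhaseSpace n × PhaseSpace n => (p.1, p.2.2))
      (volume.prod (volume.prod volume)) (volume.prod volume) :=
    h1.comp ((MeasurePreserving.id volume).prod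
      Measure.measurePreserving_swap).quasiMeasurePreserving
  have h3 := (hf.aestronglyMeasurable_twist.comp_quasiMeasurePreserving h1).mul
    (Complex.continuous_conj.comp_aestronglyMeasurable
      (hf.aestronglyMeasurable_twist.comp_quasiMeasurePreserving h2))
  have h4 : (volume.restrict (unitCube n)).prod (volume.prod volume) ≪
      (volume : Measure (PhaseSpace n)).prod
        ((volume : Measure (PhaseSpace n)).prod (volume : Measure (PhaseSpace n))) :=
    Measure.restrict_le_self.absolutelyContinuous.prod Measure.AbsolutelyContinuous.rfl
  exact h3.mono_ac h4

theorem aestronglyMeasurable_correlation (hf : IsSection l f) :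
    AEStronglyMeasurable (correlation l f) volume := by
  have h1 : AEStronglyMeasurable (fun p : PhaseSpace n × PhaseSpace n =>
      twist l p.2 f p.1 * conj (f p.1)) (volume.prod volume) :=
    hf.aestronglyMeasurable_twist.mul (Complex.continuous_conj.comp_aestronglyMeasurable
      (hf.aestronglyMeasurable.comp_quasiMeasurePreserving Measure.quasiMeasurePreserving_fst))
  have h2 : AEStronglyMeasurable (fun p : PhaseSpace n × PhaseSpace n =>
      twist l p.1 f p.2 * conj (f p.2)) (volume.prod (volume.restrict (unitCube n))) :=
    h1.prod_swap.mono_ac (Measure.AbsolutelyContinuous.rfl.prod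
      Measure.restrict_le_self.absolutelyContinuous)
  exact h2.integral_prod_right'

theorem integrable_twist_mul (hf : IsSection l f) {K : PhaseSpace n → ℂ}
    (hK : Integrable K) :
    Integrable (fun p : PhaseSpace n × PhaseSpace n × PhaseSpace n =>
      (K p.2.1 * conj (K p.2.2)) * (twist l p.2.1 f p.1 * conj (twist l p.2.2 f p.1)))
      ((volume.restrict (unitCube n)).prod (volume.prod volume)) := by
  have hKK : AEStronglyMeasurable (fun p : PhaseSpace n × PhaseSpace n => K p.1 * conj (K p.2))
      (volume.prod volume) :=
    (hK.1.comp_quasiMeasurePreserving Measure.quasiMeasurePreserving_fst).mul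
      (Complex.continuous_conj.comp_aestronglyMeasurable
        (hK.1.comp_quasiMeasurePreserving Measure.quasiMeasurePreserving_snd))
  have hmeas : AEStronglyMeasurable (fun p : PhaseSpace n × PhaseSpace n × PhaseSpace n =>
      (K p.2.1 * conj (K p.2.2)) * (twist l p.2.1 f p.1 * conj (twist l p.2.2 f p.1)))
      ((volume.restrict (unitCube n)).prod (volume.prod volume)) :=
    (hKK.comp_quasiMeasurePreserving (Measure.quasiMeasurePreserving_snd
      (μ := volume.restrict (unitCube n)))).mul hf.aestronglyMeasurable_twist_mul
  refine ⟨hmeas, ?_⟩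
  rw [HasFiniteIntegral, lintegral_prod_symm _ hmeas.enorm]
  calc _ ≤ ∫⁻ p : PhaseSpace n × PhaseSpace n, (‖K p.1‖ₑ * ‖K p.2‖ₑ) *
        (2 * ∫⁻ q in unitCube n, ‖f q‖ₑ ^ 2) ∂(volume.prod volume) := by
        refine lintegral_mono fun p => ?_
        refine le_trans (le_of_eq ?_) (mul_le_mul_right (hf.lintegral_mul_le p.1 p.2) _)
        rw [← lintegral_const_mul' _ _ (ENNReal.mul_ne_top enorm_ne_top enorm_ne_top)]
        refine lintegral_congr fun q => ?_
        simp [twist, enorm_mul]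
    _ = (∫⁻ g, ‖K g‖ₑ) * (∫⁻ g, ‖K g‖ₑ) * (2 * ∫⁻ q in unitCube n, ‖f q‖ₑ ^ 2) := by
        rw [lintegral_mul_const', lintegral_prod_mul hK.1.enorm hK.1.enorm]
        exact ENNReal.mul_ne_top ENNReal.ofNat_ne_top hf.lintegral_enorm_sq_lt_top.ne
    _ < ⊤ := ENNReal.mul_lt_top (ENNReal.mul_lt_top hK.2 hK.2)
        (ENNReal.mul_lt_top ENNReal.ofNat_lt_top hf.lintegral_enorm_sq_lt_top)

/-- The square is written as a double integral in (g, g'), the cube integral is taken first, and the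
shear g = c + g' isolates the difference on which the matrix coefficient depends. -/
theorem integral_norm_sq_twist_average (hf : IsSection l f) {K : PhaseSpace n → ℂ}
    (hK : Integrable K) :
    ∫ q in unitCube n, ((‖∫ g, K g * twist l g f q‖ ^ 2 : ℝ) : ℂ) =
      ∫ c, correlation l f c *
        ∫ g, K (c + g) * conj (K g) * unitPhase (l / 2 * symp g c) := by
  have hint := hf.integrable_twist_mul hK
  set Ψ : PhaseSpace n × PhaseSpace n → ℂ := fun p =>
    K p.1 * conj (K p.2) * (unitPhase (l / 2 * symp p.2 p.1) * correlation l f (p.1 - p.2)) with hΨ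
  have hΨeq : ∀ p : PhaseSpace n × PhaseSpace n, ∫ q in unitCube n,
      (K p.1 * conj (K p.2)) * (twist l p.1 f q * conj (twist l p.2 f q)) = Ψ p := fun p => by
    rw [integral_const_mul, hf.integral_twist_mul_conj_twist]
  have hΨint : Integrable Ψ (volume.prod volume) := by
    refine hint.integral_prod_right.congr (Filter.Eventually.of_forall hΨeq)
  have hT := (measurePreserving_add_prod (volume : Measure (PhaseSpace n)) volume)
  have hΨT := hT.integrable_comp_of_integrable hΨint
  calc ∫ q in unitCube n, ((‖∫ g, K g * twist l g f q‖ ^ 2 : ℝ) : ℂ)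
      = ∫ q in unitCube n, ∫ p : PhaseSpace n × PhaseSpace n,
          (K p.1 * conj (K p.2)) * (twist l p.1 f q * conj (twist l p.2 f q))
            ∂(volume.prod volume) := by
        refine integral_congr_ae (Filter.Eventually.of_forall fun q => ?_)
        simp only
        rw [Complex.ofReal_pow, ← Complex.mul_conj', ← integral_conj, ← integral_prod_mul]
        congr 1 with p
        rw [map_mul]
        ring
    _ = ∫ p : PhaseSpace n × PhaseSpace n, Ψ p ∂(volume.prod volume) := by
        rw [integral_integral_swap hint]
        simp_rw [hΨeq]
    _ = ∫ g' : PhaseSpace n, ∫ c : PhaseSpace n, Ψ (c + g', g') := by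
        rw [integral_prod_symm _ hΨint]
        congr 1 with g'
        exact (integral_add_right_eq_self (fun c => Ψ (c, g')) g').symm
    _ = ∫ c : PhaseSpace n, ∫ g' : PhaseSpace n, Ψ (c + g', g') :=
        (integral_integral_swap (f := fun c g' => Ψ (c + g', g')) hΨT).symm
    _ = _ := by
        congr 1 with c
        rw [← integral_const_mul]
        congr 1 with g'
        simp only [hΨ, add_sub_cancel_right, symp_add_right, symp_self, add_zero]
        ring

end IsSection

/-! ### Continuity of the correlation at the origin -/

theorem exists_sqNorm_le_of_norm_le (n : ℕ) (r : ℝ) :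
    ∃ R : ℝ, ∀ c : PhaseSpace n, ‖c‖ ≤ r → sqNorm c ≤ R := by
  obtain ⟨R, hR⟩ := (isCompact_closedBall (0 : PhaseSpace n) r).exists_bound_of_continuousOn
    continuous_sqNorm.continuousOn
  exact ⟨R, fun c hc => (le_abs_self _).trans (hR c (by simpa using hc))⟩

theorem setLIntegral_mul_comp_sub_le {D h : PhaseSpace n → ENNReal} (hD : AEMeasurable D)
    (hh : AEMeasurable h) (s : Set (PhaseSpace n)) (c : PhaseSpace n) :
    ∫⁻ q in s, D (q - c) * h q ≤
      (∫⁻ q, D q ^ (2 : ℝ)) ^ (1 / 2 : ℝ) * (∫⁻ q in s, h q ^ (2 : ℝ)) ^ (1 / 2 : ℝ) := by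
  have hDc : AEMeasurable (fun q => D (q - c)) :=
    hD.comp_quasiMeasurePreserving (measurePreserving_sub_right volume c).quasiMeasurePreserving
  refine (ENNReal.lintegral_mul_le_Lp_mul_Lq _ Real.HolderConjugate.two_two hDc.restrict
    hh.restrict).trans ?_
  have h1 : ∫⁻ q in s, D (q - c) ^ (2 : ℝ) ≤ ∫⁻ q, D q ^ (2 : ℝ) :=
    (setLIntegral_le_lintegral _ _).trans
      (lintegral_sub_right_eq_self (fun q => D q ^ (2 : ℝ)) c).le
  gcongr

theorem continuous_integral_twist_mul (l : ℝ) {ψ f : PhaseSpace n → ℂ} (hψ : Continuous ψ)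
    (hψs : HasCompactSupport ψ) {s : Set (PhaseSpace n)} (hf : IntegrableOn f s) :
    Continuous fun c => ∫ q in s, twist l c ψ q * conj (f q) := by
  obtain ⟨C, hC⟩ := hψs.exists_bound_of_continuous hψ
  have htw : Continuous fun p : PhaseSpace n × PhaseSpace n => twist l p.1 ψ p.2 :=
    (continuous_unitPhase.comp (continuous_const.mul
      (continuous_symp.comp continuous_swap))).mul (hψ.comp (by fun_prop))
  refine continuous_of_dominated (bound := fun q => C * ‖f q‖) (fun c => ?_) (fun c => ?_)
    (hf.norm.const_mul C) ?_
  · exact (htw.comp (Continuous.prodMk_right c)).aestronglyMeasurable.mul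
      (Complex.continuous_conj.comp_aestronglyMeasurable hf.1)
  · refine Filter.Eventually.of_forall fun q => ?_
    rw [norm_mul, norm_twist, RCLike.norm_conj]
    gcongr
    exact hC _
  · exact Filter.Eventually.of_forall fun q =>
      (htw.comp (Continuous.prodMk_left q)).mul continuous_const

namespace IsSection

variable {l : ℝ} {f : PhaseSpace n → ℂ}

/-- A section is only locally square integrable. Gaussian damping makes it globally so, and hence
approximable in L² by continuous functions of compact support. -/
theorem memLp_mul_exp_neg_sqNorm (hf : IsSection l f) :
    MemLp (fun q => f q * (Real.exp (-sqNorm q) : ℂ)) 2 := by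
  have hcont : Continuous fun q : PhaseSpace n => Real.exp (-sqNorm q) :=
    continuous_sqNorm.neg.rexp
  refine ⟨hf.aestronglyMeasurable.mul
    (Complex.continuous_ofReal.comp hcont).aestronglyMeasurable, ?_⟩
  rw [eLpNorm_lt_top_iff_lintegral_rpow_enorm_lt_top two_ne_zero ENNReal.ofNat_ne_top]
  refine lt_of_eq_of_lt (lintegral_congr fun q => ?_) (lintegral_periodic_mul_exp_lt_top
    (φ := fun q => ‖f q‖ₑ ^ 2) (hf.aestronglyMeasurable.enorm.pow_const 2)
    (fun q m => by rw [hf.enorm_periodic]) hf.lintegral_enorm_sq_lt_top two_pos)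
  rw [ENNReal.toReal_ofNat, ENNReal.rpow_ofNat, enorm_mul, mul_pow,
    ← ofReal_norm ((_ : ℝ) : ℂ), Complex.norm_real, Real.norm_of_nonneg (Real.exp_pos _).le,
    ← ENNReal.ofReal_pow (Real.exp_pos _).le, ← Real.exp_nat_mul]
  congr 3
  push_cast
  ring

theorem integrableOn_twist_mul (hf : IsSection l f) (c : PhaseSpace n) :
    IntegrableOn (fun q => twist l c f q * conj (f q)) (unitCube n) := by
  have h1 : Continuous fun q : PhaseSpace n => unitPhase (l / 2 * symp q c) :=
    continuous_unitPhase.comp (continuous_const.mul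
      (continuous_symp.comp (Continuous.prodMk_left c)))
  refine ⟨((h1.aestronglyMeasurable.mul (hf.aestronglyMeasurable_comp_sub c)).mul
    (Complex.continuous_conj.comp_aestronglyMeasurable hf.aestronglyMeasurable)).restrict, ?_⟩
  refine lt_of_le_of_lt (le_trans (le_of_eq (lintegral_congr fun q => ?_))
    (hf.lintegral_mul_le c 0))
    (ENNReal.mul_lt_top ENNReal.ofNat_lt_top hf.lintegral_enorm_sq_lt_top)
  simp [twist, enorm_mul]

/-- A locally uniform limit of continuous functions: one factor f is replaced by χ, a compactly
supported L² approximation of the damped section with the damping undone. Cauchy–Schwarz bounds the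
error uniformly for ‖c‖ < 1. -/
theorem continuousAt_correlation (hf : IsSection l f) : ContinuousAt (correlation l f) 0 := by
  refine continuousAt_of_locally_uniform_approx_of_continuousAt fun u hu => ?_
  obtain ⟨ε, hε, hεu⟩ := mem_uniformity_edist.1 hu
  -- For q in the cube and ‖c‖ < 1 one has ‖q - c‖ ≤ 2, so undoing the damping costs at most e^R.
  obtain ⟨R, hR⟩ := exists_sqNorm_le_of_norm_le n 2
  set N := (∫⁻ q in unitCube n, ‖f q‖ₑ ^ (2 : ℝ)) ^ (1 / 2 : ℝ) with hN
  have hNfin : N ≠ ⊤ := by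
    refine ENNReal.rpow_ne_top_of_nonneg (by norm_num) ?_
    simpa using hf.lintegral_enorm_sq_lt_top.ne
  obtain ⟨η, hη, hηε⟩ := ENNReal.exists_nnreal_pos_mul_lt
    (ENNReal.mul_ne_top (ENNReal.ofReal_ne_top (r := Real.exp R)) hNfin) hε.ne'
  have : IsLocallyFiniteMeasure (volume : Measure (PhaseSpace n)) :=
    isLocallyFiniteMeasure_of_isFiniteMeasureOnCompacts
  obtain ⟨ψ, hψs, hψd, hψc, hψL⟩ :=
    hf.memLp_mul_exp_neg_sqNorm.exists_hasCompactSupport_eLpNorm_sub_le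
      ENNReal.ofNat_ne_top (ENNReal.coe_ne_zero.2 hη.ne')
  set F : PhaseSpace n → ℂ := fun q => f q * (Real.exp (-sqNorm q) : ℂ)
  set χ : PhaseSpace n → ℂ := fun q => ψ q * (Real.exp (sqNorm q) : ℂ) with hχ
  have hχc : Continuous χ := hψc.mul
    (Complex.continuous_ofReal.comp continuous_sqNorm.rexp)
  have hχs : HasCompactSupport χ := hψs.mul_right
  have hfi : IntegrableOn f (unitCube n) := hf.memLp.integrable one_le_two
  refine ⟨Metric.ball 0 1, Metric.ball_mem_nhds 0 one_pos,
    fun c => ∫ q in unitCube n, twist l c χ q * conj (f q),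
    (continuous_integral_twist_mul l hχc hχs hfi).continuousAt, fun c hc => hεu ?_⟩
  have hint2 : IntegrableOn (fun q => twist l c χ q * conj (f q)) (unitCube n) := by
    obtain ⟨C, hC⟩ := hχs.exists_bound_of_continuous hχc
    have h1 : Continuous (twist l c χ) :=
      (continuous_unitPhase.comp (continuous_const.mul
        (continuous_symp.comp (Continuous.prodMk_left c)))).mul (hχc.comp (by fun_prop))
    refine (hfi.norm.const_mul C).mono' (h1.aestronglyMeasurable.mul
      (Complex.continuous_conj.comp_aestronglyMeasurable hfi.1))
      (Filter.Eventually.of_forall fun q => ?_)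
    rw [norm_mul, norm_twist, RCLike.norm_conj]
    gcongr
    exact hC _
  rw [edist_eq_enorm_sub, correlation, ← integral_sub (hf.integrableOn_twist_mul c) hint2]
  refine (enorm_integral_le_lintegral_enorm _).trans_lt ?_
  have hFψ : AEMeasurable fun q => ‖F q - ψ q‖ₑ :=
    (hf.memLp_mul_exp_neg_sqNorm.1.sub hψc.aestronglyMeasurable).enorm
  calc ∫⁻ q in unitCube n, ‖twist l c f q * conj (f q) - twist l c χ q * conj (f q)‖ₑ
      ≤ ∫⁻ q in unitCube n, ENNReal.ofReal (Real.exp R) * (‖F (q - c) - ψ (q - c)‖ₑ * ‖f q‖ₑ) := by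
        refine setLIntegral_mono' measurableSet_unitCube fun q hq => ?_
        have hqc : ‖q - c‖ ≤ 2 := by
          have h1 := norm_sub_le q c
          have h2 := norm_le_one_of_mem_unitCube hq
          rw [mem_ball_zero_iff] at hc
          linarith
        have h3 : twist l c f q * conj (f q) - twist l c χ q * conj (f q) =
            unitPhase (l / 2 * symp q c) * ((Real.exp (sqNorm (q - c)) : ℝ) : ℂ) *
              ((F (q - c) - ψ (q - c)) * conj (f q)) := by
          have h4 : (Real.exp (-sqNorm (q - c)) : ℂ) * (Real.exp (sqNorm (q - c)) : ℂ) = 1 := by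
            rw [← Complex.ofReal_mul, ← Real.exp_add]; simp
          simp only [twist, hχ, F]
          linear_combination -(unitPhase (l / 2 * symp q c) * f (q - c) * conj (f q)) * h4
        have h5 : ‖((Real.exp (sqNorm (q - c)) : ℝ) : ℂ)‖ₑ ≤ ENNReal.ofReal (Real.exp R) := by
          rw [← ofReal_norm, Complex.norm_real, Real.norm_of_nonneg (Real.exp_pos _).le]
          exact ENNReal.ofReal_le_ofReal (Real.exp_le_exp.2 (hR _ hqc))
        rw [h3, enorm_mul, enorm_mul, enorm_mul, enorm_unitPhase, one_mul, RCLike.enorm_conj]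
        gcongr
    _ ≤ ENNReal.ofReal (Real.exp R) * (η * N) := by
        rw [lintegral_const_mul' _ _ ENNReal.ofReal_ne_top]
        gcongr
        refine (setLIntegral_mul_comp_sub_le hFψ hf.aestronglyMeasurable.enorm _ c).trans ?_
        gcongr
        rw [eLpNorm_eq_lintegral_rpow_enorm_toReal two_ne_zero ENNReal.ofNat_ne_top,
          ENNReal.toReal_ofNat] at hψd
        exact hψd
    _ = η * (ENNReal.ofReal (Real.exp R) * N) := by ring
    _ < ε := hηε

end IsSection

/-! ### Fourier inversion at the origin for a nonnegative transform -/

/-- The Fourier integral on phase space at frequency `β Y`. -/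
noncomputable def fourierPair (β : ℝ) (g : PhaseSpace n → ℂ) (Y : PhaseSpace n) : ℂ :=
  ∫ c, g c * unitPhase (-(β * dotPair c Y))

theorem continuous_fourierPair (β : ℝ) {g : PhaseSpace n → ℂ} (hg : Integrable g) :
    Continuous (fourierPair β g) := by
  have h : Continuous fun p : PhaseSpace n × PhaseSpace n => unitPhase (-(β * dotPair p.1 p.2)) :=
    continuous_unitPhase.comp (continuous_const.mul continuous_dotPair).neg
  refine continuous_of_dominated (bound := fun c => ‖g c‖) (fun Y => ?_) (fun Y => ?_) hg.norm ?_
  · exact hg.1.mul (h.comp (Continuous.prodMk_left Y)).aestronglyMeasurable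
  · exact Filter.Eventually.of_forall fun c => by simp
  · exact Filter.Eventually.of_forall fun c =>
      continuous_const.mul (h.comp (Continuous.prodMk_right c))

theorem norm_fourierPair_le (β : ℝ) (g : PhaseSpace n → ℂ) (Y : PhaseSpace n) :
    ‖fourierPair β g Y‖ ≤ ∫ c, ‖g c‖ :=
  (norm_integral_le_integral_norm _).trans_eq (by simp)

theorem integral_gauss_unitPhase {r : ℝ} (hr : 0 < r) (β : ℝ) (c : PhaseSpace n) :
    ∫ Y, (Real.exp (-(r ^ 2 * sqNorm Y)) : ℂ) * unitPhase (-(β * dotPair c Y)) =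
      (Real.pi / r ^ 2) ^ n * (Real.exp (-(β ^ 2 / (4 * r ^ 2) * sqNorm c)) : ℂ) := by
  have h := integral_gauss (n := n) (pow_pos hr 2) ((-(β * Complex.I)) • toC c.1)
    ((-(β * Complex.I)) • toC c.2)
  have h1 : ∀ Y : PhaseSpace n,
      (Real.exp (-(r ^ 2 * sqNorm Y)) : ℂ) * unitPhase (-(β * dotPair c Y)) =
        Complex.exp (-(r ^ 2 : ℝ) * (sqNorm Y : ℝ) + ((-(β * Complex.I)) • toC c.1 ⬝ᵥ toC Y.1 +
          (-(β * Complex.I)) • toC c.2 ⬝ᵥ toC Y.2)) := fun Y => by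
    rw [unitPhase, Complex.ofReal_exp, ← Complex.exp_add]
    congr 1
    simp only [smul_dotProduct, smul_eq_mul, dotPair]
    push_cast
    rw [ofReal_dotProduct, ofReal_dotProduct]
    ring
  simp_rw [h1, h]
  have h2 : (r : ℂ) ≠ 0 := by exact_mod_cast hr.ne'
  rw [Complex.ofReal_exp, Complex.ofReal_pow]
  congr 2
  simp only [smul_dotProduct, dotProduct_smul, smul_eq_mul]
  push_cast
  rw [ofReal_sqNorm]
  field_simp
  linear_combination (β : ℂ) ^ 2 * (toC c.1 ⬝ᵥ toC c.1 + toC c.2 ⬝ᵥ toC c.2) * Complex.I_sq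

/-- Fubini moves the Gaussian regularizer onto g as a Gaussian of width proportional to r. Rescaling
c by r then cancels its prefactor r^{-2n}, leaving a fixed Gaussian against g(r c). -/
theorem integral_gauss_mul_fourierPair {β r : ℝ} (hr : 0 < r) {g : PhaseSpace n → ℂ}
    (hg : Integrable g) :
    ∫ Y, (Real.exp (-(r ^ 2 * sqNorm Y)) : ℂ) * fourierPair β g Y =
      Real.pi ^ n * ∫ c, g (r • c) * (Real.exp (-(β ^ 2 / 4 * sqNorm c)) : ℂ) := by
  have hcont : Continuous fun p : PhaseSpace n × PhaseSpace n =>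
      unitPhase (-(β * dotPair p.2 p.1)) :=
    continuous_unitPhase.comp (continuous_const.mul
      (continuous_dotPair.comp continuous_swap)).neg
  have hint : Integrable (fun p : PhaseSpace n × PhaseSpace n =>
      (Real.exp (-(r ^ 2 * sqNorm p.1)) : ℂ) * (g p.2 * unitPhase (-(β * dotPair p.2 p.1))))
      (volume.prod volume) := by
    have h1 : Integrable (fun p : PhaseSpace n × PhaseSpace n =>
        (Real.exp (-(r ^ 2 * sqNorm p.1)) : ℂ) * g p.2) (volume.prod volume) :=
      (integrable_exp_neg_sqNorm (pow_pos hr 2)).ofReal.mul_prod hg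
    refine h1.mono ?_ (Filter.Eventually.of_forall fun p => by simp)
    simp_rw [← mul_assoc]
    exact h1.1.mul hcont.aestronglyMeasurable
  have hr0 : (r : ℂ) ≠ 0 := by exact_mod_cast hr.ne'
  calc ∫ Y, (Real.exp (-(r ^ 2 * sqNorm Y)) : ℂ) * fourierPair β g Y
      = ∫ Y : PhaseSpace n, ∫ c : PhaseSpace n, (Real.exp (-(r ^ 2 * sqNorm Y)) : ℂ) *
          (g c * unitPhase (-(β * dotPair c Y))) := by
        simp_rw [fourierPair, integral_const_mul]
    _ = ∫ c : PhaseSpace n, ∫ Y : PhaseSpace n, (Real.exp (-(r ^ 2 * sqNorm Y)) : ℂ) *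
          (g c * unitPhase (-(β * dotPair c Y))) := integral_integral_swap hint
    _ = (Real.pi / r ^ 2) ^ n *
          ∫ c, g c * (Real.exp (-(β ^ 2 / (4 * r ^ 2) * sqNorm c)) : ℂ) := by
        rw [← integral_const_mul]
        congr 1 with c
        simp_rw [mul_left_comm _ (g c)]
        rw [integral_const_mul, integral_gauss_unitPhase hr]
    _ = _ := by
        have h := Measure.integral_comp_smul (volume : Measure (PhaseSpace n))
          (fun c => g c * (Real.exp (-(β ^ 2 / (4 * r ^ 2) * sqNorm c)) : ℂ)) r
        have h2 : ∀ c : PhaseSpace n, β ^ 2 / (4 * r ^ 2) * sqNorm (r • c) =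
            β ^ 2 / 4 * sqNorm c := fun c => by
          rw [sqNorm_smul]; field_simp
        simp_rw [h2] at h
        rw [h, Module.finrank_prod, Module.finrank_fin_fun, ← two_mul, pow_mul,
          abs_of_pos (by positivity), Complex.real_smul]
        push_cast
        rw [div_pow]
        field_simp

theorem tendsto_integral_gauss_mul_fourierPair {β : ℝ} (hβ : 0 < β) {g : PhaseSpace n → ℂ}
    (hg : Integrable g) {B : ℝ} (hB : ∀ c, ‖g c‖ ≤ B) (h0 : ContinuousAt g 0)
    {r : ℕ → ℝ} (hr : ∀ m, 0 < r m) (hrt : Filter.Tendsto r Filter.atTop (𝓝 0)) :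
    Filter.Tendsto (fun m => ∫ Y, (Real.exp (-(r m ^ 2 * sqNorm Y)) : ℂ) * fourierPair β g Y)
      Filter.atTop (𝓝 (((2 * Real.pi / β) ^ (2 * n) : ℝ) * g 0)) := by
  simp_rw [fun m => integral_gauss_mul_fourierPair (β := β) (hr m) hg]
  have hb : 0 < β ^ 2 / 4 := by positivity
  have hlim : (((2 * Real.pi / β) ^ (2 * n) : ℝ) : ℂ) * g 0 =
      Real.pi ^ n * ∫ c : PhaseSpace n, g 0 * (Real.exp (-(β ^ 2 / 4 * sqNorm c)) : ℂ) := by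
    rw [integral_const_mul, integral_complex_ofReal, integral_exp_neg_sqNorm hb, pow_mul]
    -- The constant of inversion is π from the regularizer times the mass factor π / (β²/4) of the
    -- limiting Gaussian, each to the power n.
    have : (2 * Real.pi / β) ^ 2 = Real.pi * (Real.pi / (β ^ 2 / 4)) := by
      field_simp; ring
    rw [this, mul_pow]
    push_cast
    ring
  rw [hlim]
  refine Filter.Tendsto.const_mul _ ?_
  refine tendsto_integral_of_dominated_convergence
    (fun c => B * Real.exp (-(β ^ 2 / 4 * sqNorm c))) (fun m => ?_)
    ((integrable_exp_neg_sqNorm hb).const_mul B) (fun m => Filter.Eventually.of_forall fun c => ?_)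
    (Filter.Eventually.of_forall fun c => ?_)
  · have h1 : Continuous fun c : PhaseSpace n => Real.exp (-(β ^ 2 / 4 * sqNorm c)) :=
      (continuous_const.mul continuous_sqNorm).neg.rexp
    exact ((integrable_comp_smul_iff volume g (hr m).ne').2 hg).1.mul
      (Complex.continuous_ofReal.comp h1).aestronglyMeasurable
  · rw [norm_mul, Complex.norm_real, Real.norm_of_nonneg (Real.exp_pos _).le]
    gcongr
    exact hB _
  · refine Filter.Tendsto.mul_const _ ?_
    refine h0.tendsto.comp ?_
    simpa using hrt.smul_const c

/-- Inversion at one point without assuming the transform integrable: because J ≥ 0, the regularized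
integrals increase to ∫ J by monotone convergence, while Gaussian summation identifies their limit
through the value of g at 0. -/
theorem lintegral_of_fourierPair_nonneg {β : ℝ} (hβ : 0 < β) {g : PhaseSpace n → ℂ}
    (hg : Integrable g) {B : ℝ} (hB : ∀ c, ‖g c‖ ≤ B) (h0 : ContinuousAt g 0)
    {J : PhaseSpace n → ℝ} (hJ : ∀ Y, 0 ≤ J Y) (hJg : ∀ Y, (J Y : ℂ) = fourierPair β g Y)
    {a : ℝ} (ha : g 0 = a) :
    ∫⁻ Y, ENNReal.ofReal (J Y) = ENNReal.ofReal ((2 * Real.pi / β) ^ (2 * n) * a) := by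
  have hJc : Continuous J := by
    have h := Complex.continuous_re.comp (continuous_fourierPair β hg)
    refine h.congr fun Y => ?_
    rw [Function.comp_apply, ← hJg, Complex.ofReal_re]
  have hs := continuous_sqNorm (n := n)
  have hJB : ∀ Y, J Y ≤ ∫ c, ‖g c‖ := fun Y => by
    have h := norm_fourierPair_le β g Y
    rwa [← hJg, Complex.norm_real, Real.norm_of_nonneg (hJ Y)] at h
  -- Any positive sequence decreasing to 0 serves; monotonicity is what makes the regularizers
  -- increase.
  set r : ℕ → ℝ := fun m => 1 / ((m : ℝ) + 1) with hr
  have hrpos : ∀ m, 0 < r m := fun m => by positivity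
  have hrt : Filter.Tendsto r Filter.atTop (𝓝 0) := tendsto_one_div_add_atTop_nhds_zero_nat
  have hint : ∀ m, Integrable fun Y => Real.exp (-(r m ^ 2 * sqNorm Y)) * J Y := fun m => by
    refine ((integrable_exp_neg_sqNorm (n := n) (pow_pos (hrpos m) 2)).mul_const
      (∫ c, ‖g c‖)).mono' (by fun_prop) (Filter.Eventually.of_forall fun Y => ?_)
    rw [Real.norm_of_nonneg (mul_nonneg (Real.exp_pos _).le (hJ Y))]
    gcongr
    exact hJB Y
  have h1 := tendsto_integral_gauss_mul_fourierPair hβ hg hB h0 hrpos hrt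
  have h2 : ∀ m, ∫ Y, (Real.exp (-(r m ^ 2 * sqNorm Y)) : ℂ) * fourierPair β g Y =
      ((∫ Y, Real.exp (-(r m ^ 2 * sqNorm Y)) * J Y : ℝ) : ℂ) := fun m => by
    rw [← integral_complex_ofReal]
    simp_rw [← hJg, Complex.ofReal_mul]
  simp_rw [h2, ha, ← Complex.ofReal_mul] at h1
  have h3 := (Complex.continuous_re.tendsto _).comp h1
  simp only [Function.comp_def, Complex.ofReal_re] at h3
  have h4 := ENNReal.tendsto_ofReal h3
  have h5 : ∀ m, ENNReal.ofReal (∫ Y, Real.exp (-(r m ^ 2 * sqNorm Y)) * J Y) =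
      ∫⁻ Y, ENNReal.ofReal (Real.exp (-(r m ^ 2 * sqNorm Y)) * J Y) := fun m =>
    ofReal_integral_eq_lintegral_ofReal (hint m)
      (Filter.Eventually.of_forall fun Y => mul_nonneg (Real.exp_pos _).le (hJ Y))
  simp_rw [h5] at h4
  refine tendsto_nhds_unique (lintegral_tendsto_of_tendsto_of_monotone (fun m => ?_) ?_ ?_) h4
  · exact (hint m).1.aemeasurable.ennreal_ofReal
  · refine Filter.Eventually.of_forall fun Y m m' hmm' => ENNReal.ofReal_le_ofReal ?_
    refine mul_le_mul_of_nonneg_right (Real.exp_le_exp.2 ?_) (hJ Y)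
    have h6 : r m' ≤ r m := one_div_le_one_div_of_le (by positivity) (by gcongr)
    have h7 := sqNorm_nonneg Y
    have h8 := (hrpos m').le
    gcongr
  · refine Filter.Eventually.of_forall fun Y => ?_
    have h6 : Filter.Tendsto (fun m => Real.exp (-(r m ^ 2 * sqNorm Y)) * J Y) Filter.atTop
        (𝓝 (Real.exp (-(0 ^ 2 * sqNorm Y)) * J Y)) :=
      ((((hrt.pow 2).mul_const _).neg).rexp).mul_const _
    simpa using ENNReal.tendsto_ofReal h6

/-! ### The transform along imaginary directions -/

/-- The kernel of `f *_l p_t^l` along the imaginary direction `Y = (y,v)`, with respect to twisted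
translations. -/
noncomputable def shiftKernel (l t : ℝ) (Y g : PhaseSpace n) : ℂ :=
  heatKerC l t (cplx g.1 Y.1) (cplx g.2 Y.2) * (Real.exp (-(l / 2 * symp Y g)) : ℂ)

theorem cplx_eq (x y : Fin n → ℝ) : cplx x y = toC x + Complex.I • toC y := rfl

theorem toC_add (x y : Fin n → ℝ) : toC (x + y) = toC x + toC y := by ext i; simp [toC]

theorem toC_sub (x y : Fin n → ℝ) : toC (x - y) = toC x - toC y := by ext i; simp [toC]

theorem ofReal_symp (q g : PhaseSpace n) :
    (symp q g : ℂ) = toC q.2 ⬝ᵥ toC g.1 - toC q.1 ⬝ᵥ toC g.2 := by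
  rw [symp, Complex.ofReal_sub, ofReal_dotProduct, ofReal_dotProduct]

theorem ofReal_dotPair (q g : PhaseSpace n) :
    (dotPair q g : ℂ) = toC q.1 ⬝ᵥ toC g.1 + toC q.2 ⬝ᵥ toC g.2 := by
  rw [dotPair, Complex.ofReal_add, ofReal_dotProduct, ofReal_dotProduct]

theorem cplx_dotProduct_self (x y : Fin n → ℝ) : cplx x y ⬝ᵥ cplx x y =
    toC x ⬝ᵥ toC x + 2 * Complex.I * (toC x ⬝ᵥ toC y) - toC y ⬝ᵥ toC y := by
  simp only [cplx_eq, add_dotProduct, dotProduct_add, smul_dotProduct, dotProduct_smul, smul_eq_mul]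
  rw [dotProduct_comm (toC y) (toC x)]
  linear_combination (toC y ⬝ᵥ toC y) * Complex.I_sq

instance : (volume : Measure (PhaseSpace n)).IsNegInvariant := by
  have : IsLocallyFiniteMeasure (volume : Measure (PhaseSpace n)) :=
    isLocallyFiniteMeasure_of_isFiniteMeasureOnCompacts
  infer_instance

/-- With q - g as integration variable the kernel no longer depends on q, and the complex phase
splits into a real exponential in q, one in g (put into `shiftKernel`) and the phase of the twisted
translation. -/
theorem transform_cplx (l t : ℝ) (f : PhaseSpace n → ℂ) (q Y : PhaseSpace n) :
    transform l t f (cplx q.1 Y.1, cplx q.2 Y.2) =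
      (Real.exp (l / 2 * symp Y q) : ℂ) * ∫ g, shiftKernel l t Y g * twist l g f q := by
  rw [transform, ← integral_const_mul, ← integral_sub_left_eq_self _ volume q]
  congr 1 with g
  have h1 : cplx q.1 Y.1 - toC (q - g).1 = cplx g.1 Y.1 := by
    ext i; simp [cplx, toC]; ring
  have h2 : cplx q.2 Y.2 - toC (q - g).2 = cplx g.2 Y.2 := by
    ext i; simp [cplx, toC]; ring
  rw [transformIntegrand, h1, h2, shiftKernel, twist]
  generalize heatKerC l t _ _ = A
  have h3 : Complex.exp (-(Complex.I * (l / 2 : ℝ) * (cplx q.2 Y.2 ⬝ᵥ toC (q - g).1 -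
      cplx q.1 Y.1 ⬝ᵥ toC (q - g).2))) = (Real.exp (l / 2 * symp Y q) : ℂ) *
      (Real.exp (-(l / 2 * symp Y g)) : ℂ) * unitPhase (l / 2 * symp q g) := by
    rw [unitPhase, Complex.ofReal_exp, Complex.ofReal_exp, ← Complex.exp_add, ← Complex.exp_add]
    congr 1
    push_cast
    rw [ofReal_symp, ofReal_symp, ofReal_symp, Prod.fst_sub, Prod.snd_sub, toC_sub, toC_sub,
      cplx_eq, cplx_eq]
    simp only [add_dotProduct, dotProduct_sub, smul_dotProduct, smul_eq_mul]
    rw [dotProduct_comm (toC q.2) (toC q.1)]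
    linear_combination (-(l / 2 : ℂ) * (toC Y.2 ⬝ᵥ toC q.1 - toC Y.2 ⬝ᵥ toC g.1 -
      toC Y.1 ⬝ᵥ toC q.2 + toC Y.1 ⬝ᵥ toC g.2)) * Complex.I_sq
  rw [h3]
  ring

theorem shiftKernel_eq (l t : ℝ) (Y g : PhaseSpace n) :
    shiftKernel l t Y g = heatConst n l t * Complex.exp (heatExp l t * sqNorm Y -
      heatExp l t * sqNorm g - 2 * Complex.I * heatExp l t * dotPair g Y - l / 2 * symp Y g) := by
  rw [shiftKernel, heatKerC_eq, Complex.ofReal_exp, mul_assoc, ← Complex.exp_add,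
    cplx_dotProduct_self, cplx_dotProduct_self]
  congr 2
  push_cast
  rw [ofReal_sqNorm, ofReal_sqNorm, ofReal_dotPair]
  ring

theorem integrable_shiftKernel {l t : ℝ} (hl : l ≠ 0) (ht : 0 < t) (Y : PhaseSpace n) :
    Integrable (shiftKernel l t Y) := by
  have h := (integrable_gauss (heatExp_pos hl ht)
    ((-(2 * Complex.I * heatExp l t)) • toC Y.1 - (l / 2 : ℂ) • toC Y.2)
    ((-(2 * Complex.I * heatExp l t)) • toC Y.2 + (l / 2 : ℂ) • toC Y.1)).const_mul
      (heatConst n l t * Complex.exp (heatExp l t * sqNorm Y))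
  refine h.congr (Filter.Eventually.of_forall fun g => ?_)
  simp only
  rw [shiftKernel_eq, mul_assoc, ← Complex.exp_add]
  congr 2
  simp only [add_dotProduct, sub_dotProduct, smul_dotProduct, smul_eq_mul]
  rw [ofReal_dotPair, ofReal_symp, dotProduct_comm (toC g.1), dotProduct_comm (toC g.2)]
  ring

/-- A Gaussian integral in g with parameter 2α. The real cross term symp Y c from completing the
square cancels the one already present, so Y and c stay coupled only through the oscillation in c·Y,
which makes the result a Fourier kernel. -/
theorem integral_shiftKernel_mul_conj {l t : ℝ} (hl : l ≠ 0) (ht : 0 < t) (Y c : PhaseSpace n) :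
    ∫ g, shiftKernel l t Y (c + g) * conj (shiftKernel l t Y g) * unitPhase (l / 2 * symp g c) =
      (heatConst n l t ^ 2 * (Real.pi / (2 * heatExp l t)) ^ n *
        Real.exp ((2 * heatExp l t + l ^ 2 / (8 * heatExp l t)) * sqNorm Y) *
        Real.exp (-((heatExp l t / 2 + l ^ 2 / (32 * heatExp l t)) * sqNorm c)) : ℝ) *
        unitPhase (-((2 * heatExp l t - l ^ 2 / (8 * heatExp l t)) * dotPair c Y)) := by
  have hα := heatExp_pos hl ht
  set α := heatExp l t with hαdef
  have h := integral_gauss (n := n) (mul_pos two_pos hα)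
    ((-(2 * α) : ℂ) • toC c.1 - (l : ℂ) • toC Y.2 - (Complex.I * l / 2) • toC c.2)
    ((-(2 * α) : ℂ) • toC c.2 + (l : ℂ) • toC Y.1 + (Complex.I * l / 2) • toC c.1)
  have h1 : ∀ g : PhaseSpace n,
      shiftKernel l t Y (c + g) * conj (shiftKernel l t Y g) * unitPhase (l / 2 * symp g c) =
      heatConst n l t ^ 2 * Complex.exp (2 * α * sqNorm Y - α * sqNorm c -
        2 * Complex.I * α * dotPair c Y - l / 2 * symp Y c) *
      Complex.exp (-(2 * α : ℝ) * (sqNorm g : ℝ) +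
        (((-(2 * α) : ℂ) • toC c.1 - (l : ℂ) • toC Y.2 - (Complex.I * l / 2) • toC c.2) ⬝ᵥ toC g.1 +
        ((-(2 * α) : ℂ) • toC c.2 + (l : ℂ) • toC Y.1 + (Complex.I * l / 2) • toC c.1) ⬝ᵥ
          toC g.2)) := fun g => by
    rw [shiftKernel_eq, shiftKernel_eq, unitPhase, map_mul, ← Complex.exp_conj, Complex.conj_ofReal,
      mul_mul_mul_comm, ← sq, mul_assoc, mul_assoc, ← Complex.exp_add, ← Complex.exp_add,
      mul_assoc _ (Complex.exp _), ← Complex.exp_add]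
    congr 2
    simp only [map_sub, map_mul, Complex.conj_ofReal, Complex.conj_I, map_div₀, map_ofNat]
    push_cast
    simp only [ofReal_sqNorm, ofReal_dotPair, ofReal_symp, Prod.fst_add, Prod.snd_add, toC_add,
      add_dotProduct, dotProduct_add, sub_dotProduct, smul_dotProduct, smul_eq_mul]
    rw [dotProduct_comm (toC g.1) (toC c.1), dotProduct_comm (toC g.2) (toC c.2),
      dotProduct_comm (toC g.2) (toC c.1), dotProduct_comm (toC g.1) (toC c.2)]
    ring
  simp_rw [h1]
  rw [integral_const_mul, h, unitPhase]
  have hα0 : (α : ℂ) ≠ 0 := by exact_mod_cast hα.ne'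
  have h2 : ∀ a b e₁ e₂ e₃ e₄ e₅ : ℂ, e₁ + e₂ = e₃ + e₄ + e₅ →
      a * Complex.exp e₁ * (b * Complex.exp e₂) =
        a * b * Complex.exp e₃ * Complex.exp e₄ * Complex.exp e₅ := by
    intro a b e₁ e₂ e₃ e₄ e₅ h
    rw [mul_mul_mul_comm, ← Complex.exp_add, h, Complex.exp_add, Complex.exp_add]
    ring
  push_cast
  refine h2 _ _ _ _ _ _ _ ?_
  simp only [ofReal_sqNorm, ofReal_dotPair, ofReal_symp, add_dotProduct, dotProduct_add,
    sub_dotProduct, dotProduct_sub, smul_dotProduct, dotProduct_smul, smul_eq_mul]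
  rw [dotProduct_comm (toC Y.2) (toC c.1), dotProduct_comm (toC Y.1) (toC c.2),
    dotProduct_comm (toC Y.1) (toC c.1), dotProduct_comm (toC Y.2) (toC c.2),
    dotProduct_comm (toC c.2) (toC c.1)]
  field_simp
  linear_combination (256 * l ^ 2 * (toC c.1 ⬝ᵥ toC c.1 + toC c.2 ⬝ᵥ toC c.2)) * Complex.I_sq

/-- This is 2 coth 2s = coth s + tanh s. It matches the decay rate of p_{2t}(2Y) with the growth in
Y found above. -/
theorem four_mul_heatExp_two_mul {l t : ℝ} (hl : l ≠ 0) (ht : 0 < t) :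
    4 * heatExp l (2 * t) = 2 * heatExp l t + l ^ 2 / (8 * heatExp l t) := by
  have hs : Real.sinh (l * t) ≠ 0 := fun h => by simpa [h] using div_sinh_pos hl ht
  have hc := (Real.cosh_pos (l * t)).ne'
  unfold heatExp
  rw [show l * (2 * t) = 2 * (l * t) by ring, Real.sinh_two_mul, Real.cosh_two_mul]
  field_simp
  ring

/-- This is coth s - tanh s = 2 / sinh 2s; it identifies the frequency of the Fourier kernel and
shows it positive. -/
theorem two_mul_heatExp_sub {l t : ℝ} (hl : l ≠ 0) (ht : 0 < t) :
    2 * heatExp l t - l ^ 2 / (8 * heatExp l t) = l / Real.sinh (l * (2 * t)) := by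
  have hs : Real.sinh (l * t) ≠ 0 := fun h => by simpa [h] using div_sinh_pos hl ht
  have hc := (Real.cosh_pos (l * t)).ne'
  unfold heatExp
  rw [show l * (2 * t) = 2 * (l * t) by ring, Real.sinh_two_mul]
  field_simp
  have := Real.cosh_sq (l * t)
  linear_combination 32 * this

/-- The inversion constant times all Gaussian prefactors. Everything is an n-th power, and the base
reduces to 1/4 by sinh 2s = 2 sinh s cosh s. -/
theorem heatConst_identity {l t : ℝ} (hl : l ≠ 0) (ht : 0 < t) :
    (2 * Real.pi / (l / Real.sinh (l * (2 * t)))) ^ (2 * n) *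
      (heatConst n l (2 * t) * (heatConst n l t ^ 2 * (Real.pi / (2 * heatExp l t)) ^ n)) =
      (4 ^ n)⁻¹ := by
  have hs : Real.sinh (l * t) ≠ 0 := fun h => by simpa [h] using div_sinh_pos hl ht
  have hc := (Real.cosh_pos (l * t)).ne'
  have hpi := Real.pi_ne_zero
  unfold heatConst heatExp
  rw [show l * (2 * t) = 2 * (l * t) by ring, Real.sinh_two_mul, pow_mul, ← inv_pow, ← inv_pow,
    ← mul_pow, ← mul_pow, pow_right_comm _ n 2, ← mul_pow, ← mul_pow, ← mul_pow]
  congr 1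
  field_simp
  norm_num

/-! ### The isometry for sections -/

namespace IsSection

variable {l t : ℝ} {f : PhaseSpace n → ℂ}

theorem correlation_zero : correlation l f 0 = ((∫ q in unitCube n, ‖f q‖ ^ 2 : ℝ) : ℂ) := by
  rw [correlation, ← integral_complex_ofReal]
  congr 1 with q
  simp [twist, Complex.mul_conj']

theorem ofReal_heatKer_mul_integral (hf : IsSection l f) (hl : l ≠ 0) (ht : 0 < t)
    (Y : PhaseSpace n) :
    ((heatKer l (2 * t) ((2 : ℝ) • Y.1) ((2 : ℝ) • Y.2) *
      ∫ q in unitCube n, ‖∫ g, shiftKernel l t Y g * twist l g f q‖ ^ 2 : ℝ) : ℂ) =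
    fourierPair (l / Real.sinh (l * (2 * t))) (fun c => ((heatConst n l (2 * t) *
      (heatConst n l t ^ 2 * (Real.pi / (2 * heatExp l t)) ^ n) *
        Real.exp (-((heatExp l t / 2 + l ^ 2 / (32 * heatExp l t)) * sqNorm c)) : ℝ) : ℂ) *
          correlation l f c) Y := by
  have h1 := hf.integral_norm_sq_twist_average (integrable_shiftKernel hl ht Y)
  rw [integral_complex_ofReal] at h1
  rw [Complex.ofReal_mul, h1, ← integral_const_mul, fourierPair, ← two_mul_heatExp_sub hl ht]
  congr 1 with c
  rw [integral_shiftKernel_mul_conj hl ht]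
  have h2 : heatKer l (2 * t) ((2 : ℝ) • Y.1) ((2 : ℝ) • Y.2) *
      Real.exp ((2 * heatExp l t + l ^ 2 / (8 * heatExp l t)) * sqNorm Y) =
        heatConst n l (2 * t) := by
    have h3 := heatKer_eq l (2 * t) ((2 : ℝ) • Y)
    rw [sqNorm_smul] at h3
    rw [← four_mul_heatExp_two_mul hl ht]
    change heatKer l (2 * t) ((2 : ℝ) • Y).1 ((2 : ℝ) • Y).2 * _ = _
    rw [h3, mul_assoc, ← Real.exp_add]
    ring_nf
    simp
  rw [← h2]
  push_cast
  ring

/-- Fourier inversion applied to the damped correlation: the Gaussian in c makes it integrable, and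
its value at 0 is the constant D times the squared norm of f over the cube. -/
theorem lintegral_heatKer_mul_integral (hf : IsSection l f) (hl : l ≠ 0) (ht : 0 < t) :
    ∫⁻ Y : PhaseSpace n, ENNReal.ofReal (heatKer l (2 * t) ((2 : ℝ) • Y.1) ((2 : ℝ) • Y.2) *
      ∫ q in unitCube n, ‖∫ g, shiftKernel l t Y g * twist l g f q‖ ^ 2) =
    ENNReal.ofReal ((4 ^ n)⁻¹ * ∫ q in unitCube n, ‖f q‖ ^ 2) := by
  obtain ⟨B, hB⟩ := hf.norm_correlation_le
  have hα := heatExp_pos hl ht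
  have h2t : 0 < 2 * t := by positivity
  set γ := heatExp l t / 2 + l ^ 2 / (32 * heatExp l t) with hγ
  have hγ0 : 0 < γ := by positivity
  set D := heatConst n l (2 * t) * (heatConst n l t ^ 2 * (Real.pi / (2 * heatExp l t)) ^ n) with hD
  have hD0 : 0 < D := by
    have h1 := heatConst_pos (n := n) hl ht
    have h2 := heatConst_pos (n := n) hl h2t
    have := Real.pi_pos
    positivity
  have hs := continuous_sqNorm (n := n)
  have hg : Continuous fun c : PhaseSpace n => D * Real.exp (-(γ * sqNorm c)) := by fun_prop
  have hle : ∀ c, ‖((D * Real.exp (-(γ * sqNorm c)) : ℝ) : ℂ) * correlation l f c‖ ≤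
      D * B * Real.exp (-(γ * sqNorm c)) := fun c => by
    rw [norm_mul, Complex.norm_real, Real.norm_of_nonneg (by positivity), mul_right_comm]
    gcongr
    exact hB c
  have hB0 : 0 ≤ B := (norm_nonneg _).trans (hB 0)
  rw [lintegral_of_fourierPair_nonneg (div_sinh_pos hl h2t)
    (g := fun c => ((D * Real.exp (-(γ * sqNorm c)) : ℝ) : ℂ) * correlation l f c)
    (B := D * B) (a := D * ∫ q in unitCube n, ‖f q‖ ^ 2) ?_ (fun c => ?_) ?_ (fun Y => ?_)
    (fun Y => hf.ofReal_heatKer_mul_integral hl ht Y), ← mul_assoc, heatConst_identity hl ht]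
  · simp only [correlation_zero, sqNorm_zero, mul_zero, neg_zero, Real.exp_zero, mul_one]
    push_cast
    rfl
  · exact ((integrable_exp_neg_sqNorm hγ0).const_mul (D * B)).mono'
      ((Complex.continuous_ofReal.comp hg).aestronglyMeasurable.mul
        hf.aestronglyMeasurable_correlation) (Filter.Eventually.of_forall hle)
  · exact (Complex.continuous_ofReal.comp hg).continuousAt.mul hf.continuousAt_correlation
  · refine (hle c).trans (mul_le_of_le_one_right (by positivity) (Real.exp_le_one_iff.2 ?_))
    have := sqNorm_nonneg c
    rw [neg_nonpos]
    positivity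
  · exact mul_nonneg (heatKer_nonneg _ _ h2t.le _ _) (integral_nonneg fun q => by positivity)

/-- The exponential in the weight is the inverse square of the factor exp((l/2) symp Y q) from
`transform_cplx`. -/
theorem bergDensity_transform {k : ℤ} (hl : l = -(4 * Real.pi * k)) (q Y : PhaseSpace n) :
    bergDensity k t (transform l t f) (q, Y) =
      heatKer l (2 * t) ((2 : ℝ) • Y.1) ((2 : ℝ) • Y.2) *
        ‖∫ g, shiftKernel l t Y g * twist l g f q‖ ^ 2 := by
  rw [bergDensity, ← hl, transform_cplx, weight, norm_mul, mul_pow, Complex.norm_real,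
    Real.norm_of_nonneg (Real.exp_pos _).le, ← Real.exp_nat_mul]
  have h : l * (q.2 ⬝ᵥ Y.1 - Y.2 ⬝ᵥ q.1) = -(((2 : ℕ) : ℝ) * (l / 2 * symp Y q)) := by
    rw [symp, dotProduct_comm q.2]
    push_cast
    ring
  simp only [h, Real.exp_neg]
  field_simp

theorem lintegral_bergDensity (hf : IsSection l f) {k : ℤ} (hl : l = -(4 * Real.pi * k))
    (hl0 : l ≠ 0) (ht : 0 < t) :
    ∫⁻ p in unitCube n ×ˢ Set.univ, ENNReal.ofReal (bergDensity k t (transform l t f) p) =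
      ENNReal.ofReal ((4 ^ n)⁻¹ * ∫ q in unitCube n, ‖f q‖ ^ 2) := by
  have hcont := continuous_bergDensity k t (hf.differentiable_transform hl0 ht).continuous
  rw [← hf.lintegral_heatKer_mul_integral hl0 ht, Measure.volume_eq_prod,
    ← Measure.prod_restrict, Measure.restrict_univ,
    lintegral_prod_symm _ hcont.measurable.ennreal_ofReal.aemeasurable]
  refine lintegral_congr fun Y => ?_
  have hint : IntegrableOn (fun q => bergDensity k t (transform l t f) (q, Y)) (unitCube n) :=
    ((hcont.comp (Continuous.prodMk_left Y)).continuousOn.integrableOn_compact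
      isCompact_Icc).mono_set unitCube_subset_Icc
  rw [← ofReal_integral_eq_lintegral_ofReal hint (Filter.Eventually.of_forall fun q => ?_)]
  · simp_rw [bergDensity_transform hl, integral_const_mul]
  · exact mul_nonneg (by positivity) (mul_nonneg (Real.exp_pos _).le
      (heatKer_nonneg _ _ (by positivity) _ _))

theorem bergDensity_nonneg (ht : 0 < t) (k : ℤ) (G : (Fin n → ℂ) × (Fin n → ℂ) → ℂ) (p) :
    0 ≤ bergDensity k t G p :=
  mul_nonneg (by positivity) (mul_nonneg (Real.exp_pos _).le
    (heatKer_nonneg _ _ (by positivity) _ _))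

theorem integrableOn_bergDensity (hf : IsSection l f) {k : ℤ} (hl : l = -(4 * Real.pi * k))
    (hl0 : l ≠ 0) (ht : 0 < t) :
    IntegrableOn (bergDensity k t (transform l t f)) (unitCube n ×ˢ Set.univ) := by
  have hcont := continuous_bergDensity k t (hf.differentiable_transform hl0 ht).continuous
  refine ⟨hcont.aestronglyMeasurable, ?_⟩
  rw [hasFiniteIntegral_iff_ofReal (Filter.Eventually.of_forall (bergDensity_nonneg ht k _)),
    hf.lintegral_bergDensity hl hl0 ht]
  exact ENNReal.ofReal_lt_top

theorem integral_bergDensity (hf : IsSection l f) {k : ℤ} (hl : l = -(4 * Real.pi * k))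
    (hl0 : l ≠ 0) (ht : 0 < t) :
    ∫ p in unitCube n ×ˢ Set.univ, bergDensity k t (transform l t f) p =
      (4 ^ n)⁻¹ * ∫ q in unitCube n, ‖f q‖ ^ 2 := by
  have hcont := continuous_bergDensity k t (hf.differentiable_transform hl0 ht).continuous
  rw [integral_eq_lintegral_of_nonneg_ae
    (Filter.Eventually.of_forall (bergDensity_nonneg ht k _)) hcont.aestronglyMeasurable,
    hf.lintegral_bergDensity hl hl0 ht, ENNReal.toReal_ofReal]
  exact mul_nonneg (by positivity) (integral_nonneg fun q => by positivity)

end IsSection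

/-! ### From ℋ_k to sections over the torus -/

theorem volume_restrict_fundDomain : (volume : Measure (PhaseSpace n × ℝ)).restrict (fundDomain n) =
    (volume.restrict (unitCube n)).prod (volume.restrict (Set.Ico (0 : ℝ) (1 / 2))) := by
  rw [fundDomain, Measure.volume_eq_prod, Measure.prod_restrict]

theorem norm_exp_four_pi (k : ℤ) (ξ : ℝ) :
    ‖Complex.exp (4 * Real.pi * Complex.I * k * ξ)‖ = 1 := by
  rw [show (4 * Real.pi * Complex.I * k * ξ : ℂ) = ((4 * Real.pi * k * ξ : ℝ) : ℂ) * Complex.I by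
    push_cast; ring]
  exact Complex.norm_exp_ofReal_mul_I _

theorem norm_eq_slice_of_mem_spaceH {k : ℤ} {F : Heis n → ℂ} (hF : F ∈ spaceH n k)
    (q : PhaseSpace n × ℝ) : ‖F ⟨q.1.1, q.1.2, q.2⟩‖ = ‖slice F q.1‖ := by
  rw [hF.2.1, norm_mul, norm_exp_four_pi, one_mul, slice]

theorem isSection_slice {k : ℤ} {l : ℝ} (hl : l = -(4 * Real.pi * k)) {F : Heis n → ℂ}
    (hF : F ∈ spaceH n k) : IsSection l (slice F) := by
  constructor
  · intro q m
    -- The central coordinate symp q m / 2 is chosen so that the product with the lattice element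
    -- has central coordinate 0; the k-equivariance of F then yields the multiplier.
    have h1 := hF.1 ⟨(intEmb n m).1, (intEmb n m).2, 0⟩ ⟨⟨m.1, rfl⟩, ⟨m.2, rfl⟩, ⟨0, by simp⟩⟩
      ⟨q.1, q.2, symp q (intEmb n m) / 2⟩
    have h2 : (⟨(intEmb n m).1, (intEmb n m).2, 0⟩ : Heis n) *
        ⟨q.1, q.2, symp q (intEmb n m) / 2⟩ = ⟨(q + intEmb n m).1, (q + intEmb n m).2, 0⟩ := by
      ext i
      · simp [add_comm]
      · simp [add_comm]
      · simp only [mul_ξ, symp]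
        rw [dotProduct_comm q.1, dotProduct_comm q.2]
        ring
    rw [h2, hF.2.1 q.1 q.2] at h1
    rw [slice, h1, slice, unitPhase, hl]
    congr 2
    push_cast
    ring
  · have h1 := hF.2.2
    rw [volume_restrict_fundDomain] at h1
    -- Multiplying by the inverse character removes the dependence on ξ, so measurability descends
    -- to the base.
    have h2 : AEStronglyMeasurable (fun p : PhaseSpace n × ℝ => slice F p.1)
        ((volume.restrict (unitCube n)).prod (volume.restrict (Set.Ico (0 : ℝ) (1 / 2)))) := by
      have hc : Continuous fun p : PhaseSpace n × ℝ =>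
          Complex.exp (-(4 * Real.pi * Complex.I * k * p.2)) := by fun_prop
      refine (hc.aestronglyMeasurable.mul h1.1).congr (Filter.Eventually.of_forall fun p => ?_)
      simp only [Pi.mul_apply]
      rw [hF.2.1 p.1.1 p.1.2 p.2, ← mul_assoc, ← Complex.exp_add, neg_add_cancel, Complex.exp_zero,
        one_mul, slice]
    have hne : volume.restrict (Set.Ico (0 : ℝ) (1 / 2)) ≠ 0 := by
      rw [Ne, Measure.restrict_eq_zero, Real.volume_Ico]
      norm_num
    have h3 : AEStronglyMeasurable (slice F) (volume.restrict (unitCube n)) := h2.of_comp_fst hne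
    rw [memLp_two_iff_integrable_sq_norm h3]
    have h4 := (memLp_two_iff_integrable_sq_norm h1.1).1 h1
    simp_rw [norm_eq_slice_of_mem_spaceH hF] at h4
    exact Integrable.of_comp_fst (f := fun q => ‖slice F q‖ ^ 2) h4 hne

theorem normM_sq_of_mem_spaceH {k : ℤ} {F : Heis n → ℂ} (hF : F ∈ spaceH n k) :
    normM F ^ 2 = 1 / 2 * ∫ q in unitCube n, ‖slice F q‖ ^ 2 := by
  rw [normM, Real.sq_sqrt (integral_nonneg fun q => by positivity), volume_restrict_fundDomain]
  simp_rw [norm_eq_slice_of_mem_spaceH hF]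
  rw [integral_fun_fst (fun q => ‖slice F q‖ ^ 2)]
  simp

theorem normB_transform {k : ℤ} {l t : ℝ} (hl : l = -(4 * Real.pi * k)) (hl0 : l ≠ 0) (ht : 0 < t)
    {F : Heis n → ℂ} (hF : F ∈ spaceH n k) :
    normB k t (transform l t (slice F)) = normM F := by
  have h1 : (0 : ℝ) ≤ normM F := Real.sqrt_nonneg _
  rw [normB, (isSection_slice hl hF).integral_bergDensity hl hl0 ht, ← Real.sqrt_sq h1,
    normM_sq_of_mem_spaceH hF]
  congr 1
  field_simp

theorem transform_mem_spaceB {k : ℤ} {l t : ℝ} (hl : l = -(4 * Real.pi * k)) (hl0 : l ≠ 0)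
    (ht : 0 < t) {f : PhaseSpace n → ℂ} (hf : IsSection l f) :
    transform l t f ∈ spaceB n k t ht := by
  refine ⟨hf.differentiable_transform hl0 ht, fun z w m m' => ?_,
    hf.integrableOn_bergDensity hl hl0 ht⟩
  rw [hf.transform_quasi, hl]
  congr 2
  push_cast
  ring

theorem transform_toC (l t : ℝ) (f : PhaseSpace n → ℂ) (x u : Fin n → ℝ) :
    transform l t f (toC x, toC u) = twistedConv l t f x u := by
  rw [transform, twistedConv]
  congr 1 with q
  rw [transformIntegrand]
  simp only [← toC_sub]
  rw [heatKerC_eq, heatKer_eq l t (x - q.1, u - q.2)]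
  push_cast
  rw [ofReal_sqNorm, ofReal_dotProduct, ofReal_dotProduct]

/-- The transform `F ↦ f *_l p_t^l` as a linear map. -/
noncomputable def transformLinear {k : ℤ} {l t : ℝ} (hl : l = -(4 * Real.pi * k)) (hl0 : l ≠ 0)
    (ht : 0 < t) : spaceH n k →ₗ[ℂ] spaceB n k t ht where
  toFun F := ⟨transform l t (slice F.1), transform_mem_spaceB hl hl0 ht (isSection_slice hl F.2)⟩
  map_add' F G := by
    refine Subtype.ext (funext fun zw => ?_)
    change transform l t (slice (F.1 + G.1)) zw =
      transform l t (slice F.1) zw + transform l t (slice G.1) zw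
    rw [transform, transform, transform, ← integral_add
      ((isSection_slice hl F.2).integrable_transformIntegrand hl0 ht zw)
      ((isSection_slice hl G.2).integrable_transformIntegrand hl0 ht zw)]
    congr 1 with q
    simp only [transformIntegrand, slice, Pi.add_apply]
    ring
  map_smul' c F := by
    refine Subtype.ext (funext fun zw => ?_)
    change transform l t (slice (c • F.1)) zw = c * transform l t (slice F.1) zw
    rw [transform, transform, ← integral_const_mul]
    congr 1 with q
    simp only [transformIntegrand, slice, Pi.smul_apply, smul_eq_mul]
    ring

/-! ### Twisted averages of Schwartz functions -/

theorem intEmb_injective : Function.Injective (intEmb n) := by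
  intro a b h
  ext i
  · have h1 : (a.1 i : ℝ) = b.1 i := congrFun (congrArg Prod.fst h) i
    exact_mod_cast h1
  · have h1 : (a.2 i : ℝ) = b.2 i := congrFun (congrArg Prod.snd h) i
    exact_mod_cast h1

theorem tsum_setLIntegral_add_intEmb (w : PhaseSpace n → ENNReal) :
    ∑' m, ∫⁻ r in unitCube n, w (r + intEmb n m) = ∫⁻ r, w r := by
  have : VAddInvariantMeasure (intLattice n) (PhaseSpace n) volume :=
    ⟨fun c s _ => measure_preimage_add volume (c : PhaseSpace n) s⟩
  rw [isAddFundamentalDomain_unitCube.lintegral_eq_tsum'' w]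
  refine Eq.trans ?_ ((AddMonoidHom.ofInjective (intEmb_injective (n := n))).toEquiv.tsum_eq
    (fun g : intLattice n => ∫⁻ x in unitCube n, w (g +ᵥ x)))
  refine tsum_congr fun m => lintegral_congr fun r => ?_
  rw [add_comm]
  rfl

theorem one_add_norm_rpow_neg_le {N : ℕ} {R : ℝ} {q r : PhaseSpace n} (h : ‖r‖ ≤ R) :
    (1 + ‖q‖) ^ (-(N : ℝ)) ≤ (1 + R) ^ N * (1 + ‖q + r‖) ^ (-(N : ℝ)) := by
  have hR : 0 ≤ R := (norm_nonneg r).trans h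
  rw [Real.rpow_neg (by positivity), Real.rpow_neg (by positivity), Real.rpow_natCast,
    Real.rpow_natCast, ← div_eq_mul_inv, inv_eq_one_div, div_le_div_iff₀ (by positivity)
    (by positivity), one_mul, ← mul_pow]
  gcongr
  nlinarith [norm_add_le q r, norm_nonneg q]

/-- Comparison with an integral: on each lattice translate of the cube the weight varies by a
bounded factor. The exponent 2n + 1 exceeds the real dimension 2n. -/
theorem summable_one_add_norm_intEmb (n : ℕ) :
    Summable fun m => (1 + ‖intEmb n m‖) ^ (-((2 * n + 1 : ℕ) : ℝ)) := by
  set N := 2 * n + 1 with hN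
  have hw : ∫⁻ r : PhaseSpace n, ENNReal.ofReal ((1 + ‖r‖) ^ (-(N : ℝ))) < ⊤ := by
    refine (integrable_one_add_norm ?_).lintegral_lt_top
    rw [Module.finrank_prod, Module.finrank_fin_fun, hN]
    push_cast
    linarith
  have h1 : (∑' m, ENNReal.ofReal ((1 + ‖intEmb n m‖) ^ (-(N : ℝ)))) * volume (unitCube n) ≤
      ENNReal.ofReal ((1 + 1) ^ N) *
        ∫⁻ r : PhaseSpace n, ENNReal.ofReal ((1 + ‖r‖) ^ (-(N : ℝ))) := by
    rw [← ENNReal.tsum_mul_right, ← tsum_setLIntegral_add_intEmb, ← ENNReal.tsum_mul_left]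
    refine ENNReal.tsum_le_tsum fun m => ?_
    rw [← lintegral_const_mul' _ _ ENNReal.ofReal_ne_top, ← setLIntegral_const]
    refine setLIntegral_mono' measurableSet_unitCube fun r hr => ?_
    rw [← ENNReal.ofReal_mul (by positivity), add_comm r]
    exact ENNReal.ofReal_le_ofReal (one_add_norm_rpow_neg_le (norm_le_one_of_mem_unitCube hr))
  have h2 : ∑' m, ENNReal.ofReal ((1 + ‖intEmb n m‖) ^ (-(N : ℝ))) ≠ ⊤ := by
    rcases ENNReal.mul_lt_top_iff.1 (h1.trans_lt (ENNReal.mul_lt_top ENNReal.ofReal_lt_top hw))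
      with h | h | h
    · exact h.1.ne
    · rw [h]; exact ENNReal.zero_ne_top
    · exact absurd h volume_unitCube_ne_zero
  refine (ENNReal.summable_toReal h2).congr fun m => ENNReal.toReal_ofReal (by positivity)

/-- One summable majorant for all q in a ball, so that the average is bounded on the cube as well as
convergent at each point. -/
theorem exists_summable_bound (f : SchwartzMap (PhaseSpace n) ℂ) (R : ℝ) :
    ∃ u : (Fin n → ℤ) × (Fin n → ℤ) → ℝ, Summable u ∧
      ∀ q, ‖q‖ ≤ R → ∀ m, ‖f (q + intEmb n m)‖ ≤ u m := by
  set N := 2 * n + 1 with hN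
  obtain ⟨C, hC⟩ : ∃ C : ℝ, ∀ x, (1 + ‖x‖) ^ N * ‖f x‖ ≤ C := by
    refine ⟨2 ^ N * ((Finset.Iic (N, 0)).sup fun m => SchwartzMap.seminorm ℝ m.1 m.2) f,
      fun x => ?_⟩
    simpa using SchwartzMap.one_add_le_sup_seminorm_apply (𝕜 := ℝ) (m := (N, 0)) (k := N) (n := 0)
      le_rfl le_rfl f x
  have hC0 : 0 ≤ C := le_trans (by positivity) (hC 0)
  refine ⟨fun m => C * (1 + R) ^ N * (1 + ‖intEmb n m‖) ^ (-(N : ℝ)),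
    (summable_one_add_norm_intEmb n).mul_left _, fun q hq m => ?_⟩
  have h1 : ‖f (q + intEmb n m)‖ ≤ C * (1 + ‖q + intEmb n m‖) ^ (-(N : ℝ)) := by
    rw [Real.rpow_neg (by positivity), Real.rpow_natCast, ← div_eq_mul_inv,
      le_div_iff₀ (by positivity), mul_comm]
    exact hC _
  have h2 := one_add_norm_rpow_neg_le (N := N) (q := q + intEmb n m) (r := -q)
    ((norm_neg q).trans_le hq)
  rw [add_neg_cancel_comm] at h2
  exact h1.trans ((mul_le_mul_of_nonneg_left h2 hC0).trans_eq (by ring))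

theorem avgTerm_eq (l : ℝ) (f : PhaseSpace n → ℂ) (q : PhaseSpace n) (m) :
    avgTerm l f q m = unitPhase (l / 2 * symp q (intEmb n m)) * f (q + intEmb n m) := by
  rw [avgTerm, unitPhase]
  congr 1
  congr 1
  rw [Complex.ofReal_mul, mul_comm Complex.I, mul_right_comm]
  rfl

theorem norm_avgTerm (l : ℝ) (f : PhaseSpace n → ℂ) (q : PhaseSpace n) (m) :
    ‖avgTerm l f q m‖ = ‖f (q + intEmb n m)‖ := by
  rw [avgTerm_eq, norm_mul, norm_unitPhase, one_mul]

theorem summable_avgTerm (l : ℝ) (f : SchwartzMap (PhaseSpace n) ℂ) (q : PhaseSpace n) :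
    Summable (avgTerm l f q) := by
  obtain ⟨u, hu, h⟩ := exists_summable_bound f ‖q‖
  exact hu.of_norm_bounded fun m => (norm_avgTerm l f q m).trans_le (h q le_rfl m)

theorem symp_intEmb (m m' : (Fin n → ℤ) × (Fin n → ℤ)) :
    symp (intEmb n m) (intEmb n m') = ((m.2 ⬝ᵥ m'.1 - m.1 ⬝ᵥ m'.2 : ℤ) : ℝ) := by
  simp [symp, intEmb, dotProduct]

theorem unitPhase_int_mul_two_pi (m : ℤ) : unitPhase (m * (2 * Real.pi)) = 1 := by
  rw [unitPhase, Complex.exp_eq_one_iff]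
  exact ⟨m, by push_cast; ring⟩

/-- Reindexing m' to m' + m leaves the phase (l/2) symp m m', an integer multiple of 2π because l =
-4πk. This is where the integrality of k is used. -/
theorem twistedAvg_quasi {k : ℤ} {l : ℝ} (hl : l = -(4 * Real.pi * k)) (f : PhaseSpace n → ℂ)
    (q : PhaseSpace n) (m) : twistedAvg l f (q + intEmb n m) =
      unitPhase (-(l / 2 * symp q (intEmb n m))) * twistedAvg l f q := by
  rw [twistedAvg, twistedAvg, ← tsum_mul_left, ← (Equiv.addRight m).tsum_eq
    (fun m' => unitPhase (-(l / 2 * symp q (intEmb n m))) * avgTerm l f q m')]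
  refine tsum_congr fun m' => ?_
  rw [avgTerm_eq, avgTerm_eq, Equiv.coe_addRight, ← mul_assoc, ← unitPhase_add, map_add,
    show q + intEmb n m + intEmb n m' = q + (intEmb n m' + intEmb n m) by abel]
  congr 1
  have h : l / 2 * symp (q + intEmb n m) (intEmb n m') =
      ((-k * (m.2 ⬝ᵥ m'.1 - m.1 ⬝ᵥ m'.2) : ℤ) : ℝ) * (2 * Real.pi) +
        (-(l / 2 * symp q (intEmb n m)) + l / 2 * symp q (intEmb n m' + intEmb n m)) := by
    rw [symp_add_left, symp_add_right, symp_intEmb, hl]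
    push_cast
    ring
  rw [h, unitPhase_add, unitPhase_int_mul_two_pi, one_mul]

theorem aestronglyMeasurable_twistedAvg (l : ℝ) (f : SchwartzMap (PhaseSpace n) ℂ)
    (μ : Measure (PhaseSpace n)) : AEStronglyMeasurable (twistedAvg l f) μ := by
  refine aestronglyMeasurable_of_tendsto_ae Filter.atTop
    (f := fun (s : Finset ((Fin n → ℤ) × (Fin n → ℤ))) q => ∑ m ∈ s, avgTerm l f q m)
    (fun s => Continuous.aestronglyMeasurable ?_)
    (Filter.Eventually.of_forall fun q => (summable_avgTerm l f q).hasSum)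
  refine continuous_finsetSum _ fun m _ => ?_
  simp_rw [avgTerm_eq]
  have h1 : Continuous fun q : PhaseSpace n => symp q (intEmb n m) :=
    continuous_symp.comp (Continuous.prodMk_left _)
  have h2 := f.continuous
  exact (continuous_unitPhase.comp (continuous_const.mul h1)).mul (by fun_prop)

theorem exists_norm_twistedAvg_le (l : ℝ) (f : SchwartzMap (PhaseSpace n) ℂ) :
    ∃ C, ∀ q ∈ unitCube n, ‖twistedAvg l f q‖ ≤ C := by
  obtain ⟨u, hu, h⟩ := exists_summable_bound f 1
  exact ⟨∑' m, u m, fun q hq => tsum_of_norm_bounded hu.hasSum fun m =>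
    (norm_avgTerm l f q m).trans_le (h q (norm_le_one_of_mem_unitCube hq) m)⟩

theorem slice_lift (l : ℝ) (f : PhaseSpace n → ℂ) : slice (lift l f) = f := by
  ext q
  simp [slice, lift]

theorem lift_twistedAvg_mem_spaceH {k : ℤ} {l : ℝ} (hl : l = -(4 * Real.pi * k))
    (f : SchwartzMap (PhaseSpace n) ℂ) : lift l (twistedAvg l f) ∈ spaceH n k := by
  refine ⟨?_, fun x u ξ => ?_, ?_⟩
  · rintro γ ⟨⟨a, ha⟩, ⟨b, hb⟩, ⟨c, hc⟩⟩ h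
    have h1 : ((γ * h).x, (γ * h).u) = (h.x, h.u) + intEmb n (a, b) := by
      rw [mul_x, mul_u, ha, hb, add_comm _ h.x, add_comm _ h.u]
      rfl
    have h2 : Complex.exp (-(Complex.I * l * (γ * h).ξ)) = unitPhase ((k * c : ℤ) * (2 * Real.pi)) *
        unitPhase (l / 2 * symp (h.x, h.u) (intEmb n (a, b))) *
        Complex.exp (-(Complex.I * l * h.ξ)) := by
      -- The group law contributes the phase inverse to the multiplier of the average; the central
      -- part c/2 of γ contributes e^{2πikc} = 1.
      have h3 : γ.u ⬝ᵥ h.x - γ.x ⬝ᵥ h.u = -symp (h.x, h.u) (intEmb n (a, b)) := by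
        rw [symp, ha, hb, dotProduct_comm _ h.x, dotProduct_comm _ h.u]
        simp [intEmb]
      rw [unitPhase, unitPhase, ← Complex.exp_add, ← Complex.exp_add, mul_ξ, h3, hc]
      congr 1
      rw [hl]
      push_cast
      ring
    rw [lift, lift, h1, twistedAvg_quasi hl, h2, unitPhase_int_mul_two_pi, one_mul]
    have h4 : unitPhase (l / 2 * symp (h.x, h.u) (intEmb n (a, b))) *
        unitPhase (-(l / 2 * symp (h.x, h.u) (intEmb n (a, b)))) = 1 := by
      rw [← unitPhase_add, add_neg_cancel, unitPhase_zero]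
    linear_combination Complex.exp (-(Complex.I * l * h.ξ)) * twistedAvg l f (h.x, h.u) * h4
  · simp only [lift]
    rw [hl]
    simp only [Complex.ofReal_zero, mul_zero, neg_zero, Complex.exp_zero, one_mul]
    congr 2
    push_cast
    ring
  · obtain ⟨C, hC⟩ := exists_norm_twistedAvg_le l f
    have : IsFiniteMeasure ((volume : Measure (PhaseSpace n × ℝ)).restrict (fundDomain n)) := by
      rw [volume_restrict_fundDomain]
      infer_instance
    refine MemLp.of_bound ?_ C ?_
    · rw [volume_restrict_fundDomain]
      have hc : Continuous fun p : PhaseSpace n × ℝ =>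
          Complex.exp (-(Complex.I * l * p.2)) := by fun_prop
      exact hc.aestronglyMeasurable.mul (aestronglyMeasurable_twistedAvg l f _).comp_fst
    · have hm : MeasurableSet (fundDomain n) := measurableSet_unitCube.prod measurableSet_Ico
      refine (ae_restrict_iff' hm).2 (Filter.Eventually.of_forall fun p hp => ?_)
      have h1 : ‖Complex.exp (-(Complex.I * l * p.2))‖ = 1 := by
        rw [show -(Complex.I * l * p.2 : ℂ) = ((-(l * p.2) : ℝ) : ℂ) * Complex.I by
          push_cast; ring]
        exact Complex.norm_exp_ofReal_mul_I _
      rw [lift, norm_mul, h1, one_mul]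
      exact hC _ hp.1

end HeisNil

open HeisNil in
theorem proposition4p4 (n : ℕ) (k : ℤ) (hk : k ≠ 0) (t : ℝ) (ht : 0 < t)
    (l : ℝ) (hl : l = -(4 * Real.pi * k)) :
    (∀ f : SchwartzMap ((Fin n → ℝ) × (Fin n → ℝ)) ℂ,
      (∀ q, Summable (avgTerm l f q)) ∧
      lift l (twistedAvg l f) ∈ spaceH n k ∧
      transform l t (twistedAvg l f) ∈ spaceB n k t ht ∧
      normB k t (transform l t (twistedAvg l f)) ^ 2 = normM (lift l (twistedAvg l f)) ^ 2) ∧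
    ∃ T : spaceH n k →ₗ[ℂ] spaceB n k t ht, ∀ F : spaceH n k,
      (∀ zw, MeasureTheory.Integrable (transformIntegrand l t (slice F.1) zw)) ∧
      (∀ zw, (T F).1 zw = transform l t (slice F.1) zw) ∧
      (∀ x u, (T F).1 (toC x, toC u) = twistedConv l t (slice F.1) x u) ∧
      normB k t (T F).1 = normM F.1 := by
  have hl0 : l ≠ 0 := by
    rw [hl]
    have := Real.pi_ne_zero
    have : (k : ℝ) ≠ 0 := by exact_mod_cast hk
    simp_all
  refine ⟨fun f => ?_, transformLinear hl hl0 ht, fun F => ?_⟩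
  · have hmem := lift_twistedAvg_mem_spaceH hl f
    have hsec := isSection_slice hl hmem
    have hnorm := normB_transform hl hl0 ht hmem
    -- The average is the slice of its own lift, so the isometry on ℋ_k applies to it directly.
    rw [slice_lift] at hsec hnorm
    exact ⟨summable_avgTerm l f, hmem, transform_mem_spaceB hl hl0 ht hsec, by rw [hnorm]⟩
  · exact ⟨(isSection_slice hl F.2).integrable_transformIntegrand hl0 ht, fun _ => rfl,
      transform_toC l t (slice F.1), normB_transform hl hl0 ht F.2⟩
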